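/- Let $M$ be a connected $C^\infty$ manifold of dimension $n\ge 3$ and let $F:TM\to[0,\infty)$ be a Finsler metric on $M$: $F$ is smooth and positive on $TM_0=TM\setminus\{0\}$, $F(x,\lambda y)=\lambda F(x,y)$ for $\lambda\ge 0$, and for all $y\neq 0$ the fundamental form $\mathbf g_y(u,v)=\frac12\frac{\partial^2}{\partial s\partial t}F^2(y+su+tv)|_{s=t=0}$ is positive definite. Suppose that $F$ is an $m$-th root metric for some integer $m\ge 1$, that is, $F=\sqrt[m]{A}$ with $A(x,y)=a_{i_1\dots i_m}(x)\,y^{i_1}\cdots y^{i_m}$ and $a_{i_1\dots i_m}$ symmetric in its indices, and that $F$ is not Riemannian (it is not the case that $F^2$ is a quadratic form on every tangent space). In local coordinates put $g_{ij}=\frac12\frac{\partial^2F^2}{\partial y^i\partial y^j}$, $(g^{ij})=(g_{ij})^{-1}$, $y_i=g_{ij}y^j$, $h_{ij}=g_{ij}-F^{-2}y_iy_j$, $h^i_k=g^{ij}h_{jk}$, $G^i=\frac14 g^{ik}\left\{2\frac{\partial g_{pk}}{\partial x^q}-\frac{\partial g_{pq}}{\partial x^k}\right\}y^py^q$ and $$R^i_k=2\frac{\partial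 G^i}{\partial x^k}-y^j\frac{\partial^2G^i}{\partial x^j\partial y^k}+2G^j\frac{\partial^2G^i}{\partial y^j\partial y^k}-\frac{\partial G^i}{\partial y^j}\frac{\partial G^j}{\partial y^k}.$$ Suppose that $F$ is of scalar flag curvature $\mathbf K=\mathbf K(x,y)$, that is, $R^i_k=\mathbf K F^2h^i_k$ for $y\ne 0$, and that $$\mathbf K=\frac{3\theta}{F}+\sigma\quad\text{on } TM_0$$ for some 1-form $\theta$ on $M$ and some scalar function $\sigma=\sigma(x)$ on $M$. Then $\mathbf K=0$ on $TM_0$. -/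

import Mathlib

open scoped Manifold ContDiff

noncomputable section

namespace Finsler

/-- The coordinate space `ℝⁿ`. -/
abbrev Coord (n : ℕ) : Type := EuclideanSpace ℝ (Fin n)

/-! ### Coordinate calculus

Throughout, a function on (an open part of) the tangent bundle of `ℝⁿ` is written
`f : Coord n → Coord n → ℝ`, `f x y`, with `x` the base point and `y` the tangent vector. -/

section LocalCoordinates

variable {n : ℕ}

/-- The partial derivative `∂f/∂x^k`. -/
def dx (k : Fin n) (f : Coord n → Coord n → ℝ) : Coord n → Coord n → ℝ :=
  fun x y => fderiv ℝ (fun x' => f x' y) x (EuclideanSpace.single k 1)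

/-- The partial derivative `∂f/∂y^k`. -/
def dy (k : Fin n) (f : Coord n → Coord n → ℝ) : Coord n → Coord n → ℝ :=
  fun x y => fderiv ℝ (fun y' => f x y') y (EuclideanSpace.single k 1)

/-- The fundamental tensor `g_{ij} = ½ ∂²(F²)/∂y^i∂y^j`. -/
def gLow (F : Coord n → Coord n → ℝ) (i j : Fin n) : Coord n → Coord n → ℝ :=
  fun x y => (1 / 2) * dy i (dy j (fun x' y' => F x' y' ^ 2)) x y

/-- The inverse `(g^{ij})` of the matrix `(g_{ij})`. -/
def gUp (F : Coord n → Coord n → ℝ) (i j : Fin n) : Coord n → Coord n → ℝ :=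
  fun x y => ((Matrix.of fun p q => gLow F p q x y)⁻¹ : Matrix (Fin n) (Fin n) ℝ) i j

/-- The spray coefficients
`G^i = ¼ g^{ik} (2 ∂g_{pk}/∂x^q - ∂g_{pq}/∂x^k) y^p y^q`. -/
def spray (F : Coord n → Coord n → ℝ) (i : Fin n) : Coord n → Coord n → ℝ :=
  fun x y => (1 / 4) * ∑ k, ∑ p, ∑ q,
    gUp F i k x y * (2 * dx q (gLow F p k) x y - dx k (gLow F p q) x y) * y p * y q

/-- The Riemann curvature
`R^i_k = 2 ∂G^i/∂x^k - y^j ∂²G^i/∂x^j∂y^k + 2 G^j ∂²G^i/∂y^j∂y^k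
  - (∂G^i/∂y^j) (∂G^j/∂y^k)`. -/
def riemann (F : Coord n → Coord n → ℝ) (i k : Fin n) : Coord n → Coord n → ℝ :=
  fun x y => 2 * dx k (spray F i) x y
    - ∑ j, y j * dx j (dy k (spray F i)) x y
    + 2 * ∑ j, spray F j x y * dy j (dy k (spray F i)) x y
    - ∑ j, dy j (spray F i) x y * dy k (spray F j) x y

/-- The lowered vector `y_i = g_{ij} y^j`. -/
def yLow (F : Coord n → Coord n → ℝ) (i : Fin n) : Coord n → Coord n → ℝ :=
  fun x y => ∑ j, gLow F i j x y * y j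

/-- The angular metric `h_{ij} = g_{ij} - F⁻² y_i y_j`. -/
def angularLow (F : Coord n → Coord n → ℝ) (i j : Fin n) : Coord n → Coord n → ℝ :=
  fun x y => gLow F i j x y - yLow F i x y * yLow F j x y / F x y ^ 2

/-- The angular metric with one index raised, `h^i_k = g^{ij} h_{jk}`. -/
def angular (F : Coord n → Coord n → ℝ) (i k : Fin n) : Coord n → Coord n → ℝ :=
  fun x y => ∑ j, gUp F i j x y * angularLow F j k x y

end LocalCoordinates

section Manifold

variable {n : ℕ} {M : Type*} [TopologicalSpace M] [ChartedSpace (Coord n) M]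

/-- The expression in the coordinates `e` of a function on the tangent bundle:
`(x, y) ↦ f (y^i ∂/∂x^i |_x)`. -/
def inChart (e : OpenPartialHomeomorph M (Coord n)) (f : TangentBundle (𝓡 n) M → ℝ) :
    Coord n → Coord n → ℝ :=
  fun x y => f ⟨e.symm x, mfderiv (𝓡 n) (𝓡 n) e.symm x y⟩

/-- The fundamental form
`g_y(u, v) = ½ ∂²/∂s∂t F²(y + s u + t v)` at `s = t = 0`. -/
def fundamentalForm (F : TangentBundle (𝓡 n) M → ℝ) (x : M) (y u v : TangentSpace (𝓡 n) x) : ℝ :=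
  (1 / 2) * deriv (fun s : ℝ => deriv (fun t : ℝ => F ⟨x, y + s • u + t • v⟩ ^ 2) 0) 0

/-- `F` is a Finsler metric on `M`: smooth away from the zero section, positive there,
positively homogeneous of degree one on each tangent space, with positive definite
fundamental form `g_y` at every `y ≠ 0`. -/
structure IsFinslerMetric (F : TangentBundle (𝓡 n) M → ℝ) [IsManifold (𝓡 n) ∞ M] : Prop where
  smooth : ContMDiffOn (𝓡 n).tangent 𝓘(ℝ, ℝ) ∞ F {v | v.2 ≠ 0}
  pos : ∀ (x : M) (y : TangentSpace (𝓡 n) x), y ≠ 0 → 0 < F ⟨x, y⟩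
  homogeneous : ∀ (x : M) (y : TangentSpace (𝓡 n) x) (c : ℝ), 0 ≤ c →
    F ⟨x, c • y⟩ = c * F ⟨x, y⟩
  posDef : ∀ (x : M) (y u : TangentSpace (𝓡 n) x), y ≠ 0 → u ≠ 0 →
    0 < fundamentalForm F x y u u

/-- `F = A^{1/m}`, where `A(x, y) = a_{i₁ … iₘ}(x) y^{i₁} ⋯ y^{iₘ}` with `a` symmetric in all
its indices. For a Finsler metric `F ≥ 0`, so `F = A^{1/m}` is the same as `F ^ m = A`, and
the coefficients are smooth because `F` is smooth off the zero section. -/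
def IsMthRoot (m : ℕ) (F : TangentBundle (𝓡 n) M → ℝ) : Prop :=
  1 ≤ m ∧ ∃ a : (x : M) → MultilinearMap ℝ (fun _ : Fin m => TangentSpace (𝓡 n) x) ℝ,
    (∀ (x : M) (π : Equiv.Perm (Fin m)) (v : Fin m → TangentSpace (𝓡 n) x),
      a x (fun i => v (π i)) = a x v) ∧
    ∀ (x : M) (y : TangentSpace (𝓡 n) x), F ⟨x, y⟩ ^ m = a x (fun _ => y)

/-- `F` is Riemannian: `F²` is a quadratic form on every tangent space. -/
def IsRiemannian (F : TangentBundle (𝓡 n) M → ℝ) : Prop :=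
  ∀ x : M, ∃ q : QuadraticForm ℝ (TangentSpace (𝓡 n) x),
    ∀ y : TangentSpace (𝓡 n) x, F ⟨x, y⟩ ^ 2 = q y

/-- `F` is of scalar flag curvature `K = K(x, y)`: in local coordinates,
`R^i_k = K F² h^i_k` for all `y ≠ 0`. -/
def HasScalarFlagCurvature (F K : TangentBundle (𝓡 n) M → ℝ) : Prop :=
  ∀ e ∈ atlas (Coord n) M, ∀ x ∈ e.target, ∀ y : Coord n, y ≠ 0 → ∀ i k : Fin n,
    riemann (inChart e F) i k x y =
      inChart e K x y * inChart e F x y ^ 2 * angular (inChart e F) i k x y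

end Manifold

end Finsler

end

/-! Parity comes first. Since `F` is positive at both `y` and `-y`, `F ^ m = A` forces `m = 2 l`,
and then `F` is reversible. Hence the spray and the Riemann curvature are even in `y`. Tracing
`R^i_k = K F² h^i_k` gives `(n - 1) K F²`, so `K` is even too. As `θ / F` is odd, it vanishes, and
`K = σ(x)`.

Schur's lemma: when `K` depends on `x` only, the Jacobi identity for the horizontal derivations
gives `∂_i σ ∂F²/∂y^j = ∂_j σ ∂F²/∂y^i`. Nondegeneracy of the Hessian then gives `dσ = 0`, so `σ` is
constant on the connected manifold (`isLocallyConstant_flagCurvature`).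

Rationality: put `Φ = F²`, so `Φ ^ l = A` is polynomial in `y`. Logarithmic derivatives of `Φ` are
rational in `y`, because `DΦ / Φ = DA / (l A)`. The factor `Φ` then cancels from the equation
defining the spray, so the spray and the curvature are rational, even though `g_ij` need not be. If
`σ(x) ≠ 0`, the trace `(n - 1) σ F²` makes `F²` rational on the fibre. Since its `l`-th power is a
polynomial and polynomial rings are integrally closed, `F²` is a polynomial, and 2-homogeneity makes
it a quadratic form (`exists_quadraticForm_of_flagCurvature_ne_zero`). At a point where `F²` is not
quadratic `σ` therefore vanishes, and by constancy it vanishes everywhere.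

Schur's lemma and rationality are proved as identities in a commutative algebra with derivations `X
i`, `Y i`, then applied to smooth functions on the slit tangent bundle of a chart. -/

noncomputable section

namespace Finsler

/-! ### Formal calculus of sprays: connection, curvature, Bianchi identities -/

/-- An algebraic model of the calculus of smooth functions `f(x, y)` on a tangent bundle in
coordinates: `X i` is `∂/∂x^i`, `Y i` is `∂/∂y^i` and `y i` is the fibre coordinate `y^i`. -/
structure TangentCalculus (ι 𝓐 : Type*) [DecidableEq ι] [CommRing 𝓐] [Algebra ℝ 𝓐] where
  X : ι → Derivation ℝ 𝓐 𝓐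
  Y : ι → Derivation ℝ 𝓐 𝓐
  y : ι → 𝓐
  X_comm : ∀ i j f, X i (X j f) = X j (X i f)
  XY_comm : ∀ i j f, X i (Y j f) = Y j (X i f)
  Y_comm : ∀ i j f, Y i (Y j f) = Y j (Y i f)
  X_y : ∀ i j, X i (y j) = 0
  Y_y : ∀ i j, Y i (y j) = if i = j then 1 else 0

theorem derivation_sum_apply {ι 𝓐 : Type*} [CommRing 𝓐] [Algebra ℝ 𝓐]
    (s : Finset ι) (D : ι → Derivation ℝ 𝓐 𝓐) (f : 𝓐) : (∑ i ∈ s, D i) f = ∑ i ∈ s, D i f := by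
  classical
  induction s using Finset.induction_on with
  | empty => simp
  | insert a s ha ih => rw [Finset.sum_insert ha, Finset.sum_insert ha, Derivation.add_apply, ih]

theorem natCast_mul_cancel {𝓐 : Type*} [CommRing 𝓐] [Algebra ℝ 𝓐] (k : ℕ) [NeZero k] {a b : 𝓐}
    (h : (k : 𝓐) * a = k * b) : a = b := by
  have h' := congrArg (fun z => algebraMap ℝ 𝓐 ((k : ℝ)⁻¹) * z) h
  have hk : algebraMap ℝ 𝓐 ((k : ℝ)⁻¹) * (k : 𝓐) = 1 := by
    rw [← map_natCast (algebraMap ℝ 𝓐), ← map_mul,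
      inv_mul_cancel₀ (Nat.cast_ne_zero.2 (NeZero.ne k)), map_one]
  simpa only [← mul_assoc, hk, one_mul] using h'

namespace TangentCalculus

variable {ι 𝓐 : Type*} [Fintype ι] [DecidableEq ι] [CommRing 𝓐] [Algebra ℝ 𝓐]
  (T : TangentCalculus ι 𝓐)

/-- The Liouville field `y^i ∂/∂y^i`. -/
def liouville : Derivation ℝ 𝓐 𝓐 := ∑ i, T.y i • T.Y i

theorem liouville_apply (f : 𝓐) : T.liouville f = ∑ i, T.y i * T.Y i f := by
  simp [liouville, derivation_sum_apply]

theorem Y_liouville (j : ι) (f : 𝓐) :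
    T.Y j (T.liouville f) = T.Y j f + T.liouville (T.Y j f) := by
  simp only [liouville_apply, map_sum, Derivation.leibniz, smul_eq_mul, T.Y_y,
    Finset.sum_add_distrib, mul_ite, mul_one, mul_zero, Finset.sum_ite_eq, Finset.mem_univ, if_true]
  rw [add_comm]
  simp only [T.Y_comm j]

theorem X_liouville (j : ι) (f : 𝓐) :
    T.X j (T.liouville f) = T.liouville (T.X j f) := by
  simp only [liouville_apply, map_sum, Derivation.leibniz, smul_eq_mul, T.X_y, mul_zero, add_zero,
    T.XY_comm j]

theorem liouville_y (i : ι) : T.liouville (T.y i) = T.y i := by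
  simp [liouville_apply, T.Y_y]

/-- The nonlinear connection `N^i_k = ∂G^i/∂y^k` of a spray. -/
def conn (G : ι → 𝓐) (i k : ι) : 𝓐 := T.Y k (G i)

/-- The horizontal derivation `δ_k = ∂/∂x^k - N^m_k ∂/∂y^m`. -/
def horiz (G : ι → 𝓐) (k : ι) : Derivation ℝ 𝓐 𝓐 :=
  T.X k - ∑ m, T.conn G m k • T.Y m

theorem horiz_apply (G : ι → 𝓐) (k : ι) (f : 𝓐) :
    T.horiz G k f = T.X k f - ∑ m, T.conn G m k * T.Y m f := by
  simp [horiz, derivation_sum_apply]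

/-- The curvature `R^i_{jk}` of the nonlinear connection. -/
def connCurv (G : ι → 𝓐) (i j k : ι) : 𝓐 :=
  T.horiz G k (T.conn G i j) - T.horiz G j (T.conn G i k)

/-- The Riemann curvature `R^i_k` of a spray. -/
def riem (G : ι → 𝓐) (i k : ι) : 𝓐 :=
  2 * T.X k (G i) - ∑ j, T.y j * T.X j (T.Y k (G i))
    + 2 * ∑ j, G j * T.Y j (T.Y k (G i)) - ∑ j, T.Y j (G i) * T.Y k (G j)

omit [Fintype ι] in
theorem Y_conn_comm (G : ι → 𝓐) (i j k : ι) : T.Y j (T.conn G i k) = T.Y k (T.conn G i j) := by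
  simp only [conn, T.Y_comm j]

/-- The defect of commutation is the Berwald connection `∂N^m_i/∂y^k`, which is symmetric in its
lower indices and so drops out of cyclic sums. -/
theorem horiz_Y (G : ι → 𝓐) (i k : ι) (f : 𝓐) :
    T.horiz G i (T.Y k f) = T.Y k (T.horiz G i f) + ∑ m, T.Y k (T.conn G m i) * T.Y m f := by
  simp only [horiz_apply, map_sub, map_sum, Derivation.leibniz, smul_eq_mul,
    Finset.sum_add_distrib, T.XY_comm, T.Y_comm k]
  have : ∑ m, T.Y m f * T.Y k (T.conn G m i) = ∑ m, T.Y k (T.conn G m i) * T.Y m f :=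
    Finset.sum_congr rfl fun _ _ => mul_comm _ _
  rw [this]; ring

theorem horiz_horiz (G : ι → 𝓐) (j k : ι) (f : 𝓐) :
    T.horiz G j (T.horiz G k f) = T.X j (T.X k f) - ∑ m, T.conn G m k * T.X j (T.Y m f)
      - ∑ m, T.conn G m j * T.X k (T.Y m f)
      + ∑ m, ∑ l, T.conn G m k * T.conn G l j * T.Y l (T.Y m f)
      - ∑ m, T.horiz G j (T.conn G m k) * T.Y m f := by
  rw [T.horiz_apply G k f, map_sub, map_sum]
  simp only [Derivation.leibniz, smul_eq_mul]
  rw [Finset.sum_add_distrib, T.horiz_apply G j (T.X k f)]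
  have h1 : ∑ m, T.conn G m k * T.horiz G j (T.Y m f) = ∑ m, T.conn G m k * T.X j (T.Y m f)
      - ∑ m, ∑ l, T.conn G m k * T.conn G l j * T.Y l (T.Y m f) := by
    rw [← Finset.sum_sub_distrib]
    refine Finset.sum_congr rfl fun m _ => ?_
    rw [horiz_apply, mul_sub, Finset.mul_sum]
    simp only [mul_assoc]
  have h2 : ∑ m, T.Y m f * T.horiz G j (T.conn G m k) = ∑ m, T.horiz G j (T.conn G m k) * T.Y m f :=
    Finset.sum_congr rfl fun _ _ => mul_comm _ _
  rw [h1, h2]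
  simp only [T.XY_comm]
  ring

theorem horiz_comm (G : ι → 𝓐) (j k : ι) (f : 𝓐) :
    T.horiz G j (T.horiz G k f) - T.horiz G k (T.horiz G j f)
      = ∑ m, T.connCurv G m j k * T.Y m f := by
  have h : ∑ m, ∑ l, T.conn G m k * T.conn G l j * T.Y l (T.Y m f)
      = ∑ m, ∑ l, T.conn G m j * T.conn G l k * T.Y l (T.Y m f) := by
    rw [Finset.sum_comm]
    refine Finset.sum_congr rfl fun m _ => Finset.sum_congr rfl fun l _ => ?_
    rw [T.Y_comm]; ring
  rw [horiz_horiz, horiz_horiz, h]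
  simp only [connCurv, sub_mul, Finset.sum_sub_distrib]
  rw [T.X_comm k j]
  ring

theorem Y_connCurv (G : ι → 𝓐) (i l j k : ι) :
    T.Y l (T.connCurv G i j k) = T.horiz G k (T.Y l (T.conn G i j))
      - ∑ m, T.Y l (T.conn G m k) * T.Y m (T.conn G i j)
      - T.horiz G j (T.Y l (T.conn G i k))
      + ∑ m, T.Y l (T.conn G m j) * T.Y m (T.conn G i k) := by
  rw [connCurv, map_sub, horiz_Y, horiz_Y]; ring

/-- By `Y_connCurv` every term involves only the symmetric second derivatives `∂²G^i/∂y^j∂y^l`, and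
the terms cancel in pairs over the cycle. -/
theorem connCurv_vertical_bianchi (G : ι → 𝓐) (i l j k : ι) :
    T.Y l (T.connCurv G i j k) + T.Y j (T.connCurv G i k l) + T.Y k (T.connCurv G i l j) = 0 := by
  simp only [Y_connCurv]
  rw [T.Y_conn_comm G i j l, T.Y_conn_comm G i k j, T.Y_conn_comm G i k l]
  simp only [T.Y_conn_comm G _ j l, T.Y_conn_comm G _ k j, T.Y_conn_comm G _ k l]
  ring

theorem connCurv_antisymm (G : ι → 𝓐) (i j k : ι) :
    T.connCurv G i j k = - T.connCurv G i k j := by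
  simp only [connCurv]; ring

section Homogeneous

variable {T} {G : ι → 𝓐} (hG : ∀ i, T.liouville (G i) = 2 * G i)
include hG

theorem sum_y_conn (i : ι) : ∑ k, T.y k * T.conn G i k = 2 * G i := by
  rw [← hG, liouville_apply]; rfl

theorem liouville_conn (i k : ι) : T.liouville (T.conn G i k) = T.conn G i k := by
  have h := T.Y_liouville k (G i)
  rw [hG, Derivation.leibniz] at h
  have h2 : T.Y k (2 : 𝓐) = 0 := by simpa using (T.Y k).map_natCast 2
  rw [h2] at h
  simp only [smul_eq_mul, mul_zero, add_zero] at h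
  rw [conn]
  linear_combination -h

theorem sum_y_Y_conn (i m : ι) : ∑ k, T.y k * T.Y m (T.conn G i k) = T.conn G i m := by
  rw [← liouville_conn hG, liouville_apply]
  exact Finset.sum_congr rfl fun k _ => by rw [T.Y_conn_comm]

theorem liouville_horiz (k : ι) (f : 𝓐) :
    T.liouville (T.horiz G k f) = T.horiz G k (T.liouville f) := by
  simp only [horiz_apply, map_sub, map_sum, Derivation.leibniz, smul_eq_mul, X_liouville,
    Y_liouville, liouville_conn hG]
  congr 1
  exact Finset.sum_congr rfl fun m _ => by ring

theorem liouville_connCurv (i j k : ι) :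
    T.liouville (T.connCurv G i j k) = T.connCurv G i j k := by
  simp only [connCurv, map_sub, liouville_horiz hG, liouville_conn hG]

/-- Euler's relations for the 2-homogeneous `G` turn the contractions of `δ_k N^i_j` and `δ_j N^i_k`
with `y^j` into the terms of the coordinate formula. -/
theorem riem_eq_sum (i k : ι) : T.riem G i k = ∑ j, T.y j * T.connCurv G i j k := by
  have h1 : ∑ j, T.y j * T.horiz G k (T.conn G i j)
      = 2 * T.X k (G i) - ∑ m, T.conn G i m * T.conn G m k := by
    simp only [horiz_apply, mul_sub, Finset.sum_sub_distrib]
    congr 1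
    · have := congrArg (T.X k) (sum_y_conn hG i)
      simpa [map_sum, Derivation.leibniz, T.X_y, two_mul] using this
    · simp only [Finset.mul_sum]
      rw [Finset.sum_comm]
      refine Finset.sum_congr rfl fun m _ => ?_
      rw [← sum_y_Y_conn hG i m, Finset.sum_mul]
      exact Finset.sum_congr rfl fun j _ => by ring
  have h2 : ∑ j, T.y j * T.horiz G j (T.conn G i k)
      = ∑ j, T.y j * T.X j (T.Y k (G i)) - 2 * ∑ j, G j * T.Y j (T.Y k (G i)) := by
    simp only [horiz_apply, mul_sub, Finset.sum_sub_distrib]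
    congr 1
    simp only [Finset.mul_sum]
    rw [Finset.sum_comm]
    refine Finset.sum_congr rfl fun m _ => ?_
    rw [← mul_assoc, ← sum_y_conn hG m, Finset.sum_mul]
    exact Finset.sum_congr rfl fun j _ => by rw [conn, conn]; ring
  simp only [connCurv, mul_sub, Finset.sum_sub_distrib]
  rw [h1, h2, riem]
  simp only [conn]
  ring

/-- Differentiate `R^i_k = y^l R^i_{lk}` and antisymmetrise. The product rule contributes two copies
of the curvature; the vertical Bianchi identity and 1-homogeneity contribute the third. -/
theorem three_mul_connCurv (i j k : ι) :
    3 * T.connCurv G i j k = T.Y j (T.riem G i k) - T.Y k (T.riem G i j) := by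
  have h (a b : ι) : T.Y a (T.riem G i b)
      = T.connCurv G i a b + ∑ l, T.y l * T.Y a (T.connCurv G i l b) := by
    rw [riem_eq_sum hG, map_sum]
    simp only [Derivation.leibniz, smul_eq_mul, T.Y_y, Finset.sum_add_distrib, mul_ite, mul_one,
      mul_zero, Finset.sum_ite_eq, Finset.mem_univ, if_true]
    rw [add_comm]
  have hs : ∑ l, T.y l * T.Y j (T.connCurv G i l k) - ∑ l, T.y l * T.Y k (T.connCurv G i l j)
      = T.connCurv G i j k := by
    rw [← liouville_connCurv hG, liouville_apply, ← Finset.sum_sub_distrib]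
    refine Finset.sum_congr rfl fun l _ => ?_
    have hb := T.connCurv_vertical_bianchi G i l j k
    rw [T.connCurv_antisymm G i k l, map_neg] at hb
    linear_combination (-T.y l) * hb
  rw [h, h, T.connCurv_antisymm G i k j]
  linear_combination -hs

end Homogeneous

end TangentCalculus

/-! ### Geodesic sprays and the algebraic form of Schur's lemma -/

namespace TangentCalculus

variable {ι 𝓐 : Type*} [Fintype ι] [DecidableEq ι] [CommRing 𝓐] [Algebra ℝ 𝓐]

theorem liouville_Y_of_homog {T : TangentCalculus ι 𝓐} {Φ : 𝓐} (hΦ : T.liouville Φ = 2 * Φ) (k : ι) :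
    T.liouville (T.Y k Φ) = T.Y k Φ := by
  have h1 := T.Y_liouville k Φ
  rw [hΦ, two_mul, map_add] at h1
  linear_combination -h1

/-- `Φ` plays the role of `F²`, with invertible vertical Hessian (inverse `S`), and `G` is its
geodesic spray. -/
structure IsGeodesicSpray (T : TangentCalculus ι 𝓐) (Φ : 𝓐) (S : Matrix ι ι 𝓐) (G : ι → 𝓐) :
    Prop where
  homog : T.liouville Φ = 2 * Φ
  inv_mul : S * (Matrix.of fun k i => T.Y k (T.Y i Φ)) = 1
  spray : ∀ k, 2 * ∑ i, T.Y k (T.Y i Φ) * G i = ∑ q, T.y q * T.X q (T.Y k Φ) - T.X k Φ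

namespace IsGeodesicSpray

variable {T : TangentCalculus ι 𝓐} {Φ : 𝓐} {S : Matrix ι ι 𝓐} {G : ι → 𝓐}
  (h : IsGeodesicSpray T Φ S G)
include h

theorem eq_of_hess_mul_eq {a b : ι → 𝓐}
    (hab : ∀ k, ∑ i, T.Y k (T.Y i Φ) * a i = ∑ i, T.Y k (T.Y i Φ) * b i) : a = b := by
  set H : Matrix ι ι 𝓐 := Matrix.of fun k i => T.Y k (T.Y i Φ) with hH
  have h1 : H.mulVec a = H.mulVec b := funext hab
  have h2 := congrArg S.mulVec h1
  rwa [Matrix.mulVec_mulVec, Matrix.mulVec_mulVec, h.inv_mul, Matrix.one_mulVec,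
    Matrix.one_mulVec] at h2

theorem liouville_Y (k : ι) : T.liouville (T.Y k Φ) = T.Y k Φ :=
  liouville_Y_of_homog h.homog k

theorem liouville_Y_Y (k i : ι) : T.liouville (T.Y k (T.Y i Φ)) = 0 := by
  have h1 := T.Y_liouville k (T.Y i Φ)
  rw [h.liouville_Y] at h1
  linear_combination -h1

/-- Apply the Liouville field to the defining equation of the spray: the Hessian has degree 0 and
the right side degree 2, so uniqueness of the solution gives the degree of `G`. -/
theorem liouville_spray (i : ι) : T.liouville (G i) = 2 * G i := by
  have : (fun i => T.liouville (G i)) = fun i => 2 * G i := by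
    apply h.eq_of_hess_mul_eq
    intro k
    have h1 := congrArg T.liouville (h.spray k)
    simp only [two_mul, map_add, map_sub, map_sum, Derivation.leibniz, smul_eq_mul,
      h.liouville_Y_Y, T.liouville_y, ← X_liouville, h.liouville_Y, h.homog, mul_zero, add_zero] at h1
    have h2 := h.spray k
    apply natCast_mul_cancel 2
    have h3 : ∑ q, (T.y q * T.X q (T.Y k Φ) + T.X q (T.Y k Φ) * T.y q)
        = 2 * ∑ q, T.y q * T.X q (T.Y k Φ) := by
      rw [Finset.mul_sum]
      exact Finset.sum_congr rfl fun q _ => by ring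
    have h4 : ∑ i, T.Y k (T.Y i Φ) * (2 * G i) = 2 * ∑ i, T.Y k (T.Y i Φ) * G i := by
      rw [Finset.mul_sum]
      exact Finset.sum_congr rfl fun q _ => by ring
    rw [h3] at h1
    rw [h4]
    push_cast
    linear_combination h1 - 2 * h2
  exact congrFun this i

/-- Contracting the spray equation with `y` says that `Φ` is constant along the spray (`hS`). Its
derivative in `y^k`, combined with the spray equation itself, leaves twice `δ_k Φ`. -/
theorem horiz_eq_zero (k : ι) : T.horiz G k Φ = 0 := by
  have hy : ∑ k, T.y k * T.Y k Φ = 2 * Φ := by rw [← liouville_apply, h.homog]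
  have hyy (i : ι) : ∑ k, T.y k * T.Y k (T.Y i Φ) = T.Y i Φ := by
    rw [← liouville_apply, h.liouville_Y]
  have hS : ∑ q, T.y q * T.X q Φ = 2 * ∑ i, G i * T.Y i Φ := by
    have h1 : ∑ k, T.y k * (2 * ∑ i, T.Y k (T.Y i Φ) * G i) = 2 * ∑ i, G i * T.Y i Φ := by
      simp only [Finset.mul_sum]
      rw [Finset.sum_comm]
      refine Finset.sum_congr rfl fun i _ => ?_
      conv_rhs => rw [← hyy i, Finset.mul_sum, Finset.mul_sum]
      exact Finset.sum_congr rfl fun k _ => by ring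
    have h2 : ∑ k, T.y k * ∑ q, T.y q * T.X q (T.Y k Φ) = 2 * ∑ q, T.y q * T.X q Φ := by
      simp only [Finset.mul_sum]
      rw [Finset.sum_comm]
      refine Finset.sum_congr rfl fun q _ => ?_
      have h3 := congrArg (T.X q) hy
      simp only [map_sum, two_mul, map_add, Derivation.leibniz, smul_eq_mul, T.X_y, mul_zero,
        add_zero] at h3
      have h4 : ∑ i, T.y i * (T.y q * T.X q (T.Y i Φ)) = T.y q * ∑ i, T.y i * T.X q (T.Y i Φ) := by
        rw [Finset.mul_sum]
        exact Finset.sum_congr rfl fun i _ => by ring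
      rw [h4, h3]; ring
    simp only [h.spray, mul_sub, Finset.sum_sub_distrib] at h1
    rw [h2] at h1
    linear_combination h1
  have hd := congrArg (T.Y k) hS
  simp only [map_sum, two_mul, map_add, Derivation.leibniz, smul_eq_mul, T.Y_y,
    Finset.sum_add_distrib, mul_ite, mul_one, mul_zero, Finset.sum_ite_eq, Finset.mem_univ,
    if_true] at hd
  have h5 : ∑ i, T.Y i Φ * T.Y k (G i) = ∑ i, T.conn G i k * T.Y i Φ :=
    Finset.sum_congr rfl fun i _ => mul_comm _ _
  have h6 : ∑ i, G i * T.Y k (T.Y i Φ) = ∑ i, T.Y k (T.Y i Φ) * G i :=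
    Finset.sum_congr rfl fun i _ => mul_comm _ _
  rw [h5, h6] at hd
  simp only [← T.XY_comm] at hd
  rw [horiz_apply]
  apply natCast_mul_cancel 2
  push_cast
  linear_combination hd + h.spray k

variable {σ : 𝓐} (hσ : ∀ i, T.Y i σ = 0)
  (hR : ∀ i k, 2 * T.riem G i k = σ * (2 * Φ * (if i = k then 1 else 0) - T.y i * T.Y k Φ))
include hσ hR

/-- Insert the isotropic form into `three_mul_connCurv`; the Hessian terms cancel by symmetry. -/
theorem connCurv_of_isotropic (i j k : ι) :
    2 * T.connCurv G i j k
      = σ * (T.Y j Φ * (if i = k then 1 else 0) - T.Y k Φ * (if i = j then 1 else 0)) := by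
  have hY (a b : ι) : 2 * T.Y a (T.riem G i b) = σ * (2 * T.Y a Φ * (if i = b then 1 else 0)
      - (if a = i then 1 else 0) * T.Y b Φ - T.y i * T.Y a (T.Y b Φ)) := by
    have h0 : T.Y a (if i = b then 1 else 0 : 𝓐) = 0 := by split_ifs <;> simp
    have h1 := congrArg (T.Y a) (hR i b)
    simp only [two_mul, map_add, map_sub, Derivation.leibniz, smul_eq_mul, hσ, T.Y_y, h0] at h1
    linear_combination h1
  apply natCast_mul_cancel 3
  have h3 := three_mul_connCurv (T := T) h.liouville_spray i j k
  have hj := hY j k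
  have hk := hY k j
  rw [T.Y_comm j k] at hj
  rw [if_congr (eq_comm (a := j) (b := i)) rfl rfl] at hj
  rw [if_congr (eq_comm (a := k) (b := i)) rfl rfl] at hk
  push_cast
  linear_combination 2 * h3 + hj - hk

theorem two_mul_horiz_comm (j k : ι) (f : 𝓐) :
    2 * (T.horiz G j (T.horiz G k f) - T.horiz G k (T.horiz G j f))
      = σ * (T.Y j Φ * T.Y k f - T.Y k Φ * T.Y j f) := by
  rw [horiz_comm, Finset.mul_sum]
  simp only [← mul_assoc, h.connCurv_of_isotropic hσ hR]
  simp only [sub_mul, mul_sub, Finset.sum_sub_distrib, mul_ite, ite_mul, mul_one, mul_zero,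
    zero_mul, Finset.sum_ite_eq', Finset.mem_univ, if_true]
  ring

/-- The Jacobi identity for `δ_i, δ_j, δ_k`, tested on `y^k`. Of the terms in `dσ` only two survive,
because `i` and `j` differ from `k`; the terms in `σ` cancel since `δ_i Y_j Φ` and the Berwald
coefficients are symmetric. -/
theorem X_mul_Y_comm {i j k : ι} (hik : i ≠ k) (hjk : j ≠ k) :
    T.X i σ * T.Y j Φ = T.X j σ * T.Y i Φ := by
  have hH : ∀ i, T.horiz G i σ = T.X i σ := fun i => by simp [horiz_apply, hσ]
  have hV (i j : ι) : T.horiz G i (T.Y j Φ) = T.horiz G j (T.Y i Φ) := by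
    simp only [horiz_Y, h.horiz_eq_zero, map_zero, zero_add, T.Y_conn_comm G _ j i]
  -- This expands `2 [δ_i, [δ_j, δ_k]] f`; its cyclic sum is zero.
  have key (i j k : ι) (f : 𝓐) :
      2 * (T.horiz G i (T.horiz G j (T.horiz G k f)) - T.horiz G i (T.horiz G k (T.horiz G j f)))
      - 2 * (T.horiz G j (T.horiz G k (T.horiz G i f)) - T.horiz G k (T.horiz G j (T.horiz G i f)))
      = T.X i σ * (T.Y j Φ * T.Y k f - T.Y k Φ * T.Y j f)
        + σ * (T.horiz G i (T.Y j Φ) * T.Y k f - T.horiz G i (T.Y k Φ) * T.Y j f)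
        + σ * (T.Y j Φ * ∑ m, T.Y k (T.conn G m i) * T.Y m f
          - T.Y k Φ * ∑ m, T.Y j (T.conn G m i) * T.Y m f) := by
    have h1 := congrArg (T.horiz G i) (h.two_mul_horiz_comm hσ hR j k f)
    have h2 := h.two_mul_horiz_comm hσ hR j k (T.horiz G i f)
    simp only [two_mul, map_add, map_sub, Derivation.leibniz, smul_eq_mul, hH] at h1
    have h3 := T.horiz_Y G i k f
    have h4 := T.horiz_Y G i j f
    linear_combination h1 - h2 + σ * T.Y j Φ * h3 - σ * T.Y k Φ * h4
  have e1 := key i j k (T.y k)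
  have e2 := key j k i (T.y k)
  have e3 := key k i j (T.y k)
  simp only [T.Y_conn_comm G _ j i, T.Y_conn_comm G _ k i, T.Y_conn_comm G _ k j] at e1 e2 e3
  simp only [T.Y_y, if_neg hik, if_neg hjk, if_true, mul_one, mul_zero] at e1 e2 e3
  linear_combination -e1 - e2 - e3 - σ * hV i j

/-- Schur's lemma in a tangent calculus with at least three base coordinates. -/
theorem X_eq_zero_of_isotropic (hι : 3 ≤ Fintype.card ι) (i : ι) : T.X i σ = 0 := by
  obtain ⟨j, hj⟩ := Finset.exists_mem_notMem_of_card_lt_card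
    (s := {i}) (t := (Finset.univ : Finset ι)) (by rw [Finset.card_singleton, Finset.card_univ]; omega)
  obtain ⟨k, hk⟩ := Finset.exists_mem_notMem_of_card_lt_card
    (s := {i, j}) (t := (Finset.univ : Finset ι))
    (by rw [Finset.card_univ]; exact lt_of_le_of_lt Finset.card_le_two (by omega))
  simp only [Finset.mem_univ, true_and, Finset.mem_insert, Finset.mem_singleton, not_or] at hj hk
  have h1 := h.X_mul_Y_comm hσ hR (Ne.symm hk.1) (Ne.symm hk.2)
  have h2 (l : ι) : T.Y l (T.Y j Φ) * T.X i σ = T.Y l (T.Y i Φ) * T.X j σ := by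
    have h3 := congrArg (T.Y l) h1
    simp only [Derivation.leibniz, smul_eq_mul, ← T.XY_comm, hσ, map_zero, mul_zero, add_zero] at h3
    linear_combination h3
  -- The relation `h2` says that the Hessian takes the same value on `∂_i σ e_j` and `∂_j σ e_i`.
  -- They are therefore equal, and since `j ≠ i` the `j`-th entry is the claim.
  have h4 : (fun m => if m = j then T.X i σ else 0) = fun m => if m = i then T.X j σ else 0 := by
    apply h.eq_of_hess_mul_eq
    intro l
    simpa using h2 l
  have h5 := congrFun h4 j
  simpa [hj] using h5

end IsGeodesicSpray

end TangentCalculus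

/-! ### Fractions with invertible denominators -/

section Fractions

variable {𝓐 : Type*} [CommRing 𝓐] [Algebra ℝ 𝓐]

/-- The fractions `p / q` with `p, q` in `P` and `q` invertible in the ambient algebra. -/
def fractions (P : Subalgebra ℝ 𝓐) : Subalgebra ℝ 𝓐 where
  carrier := {f | ∃ p ∈ P, ∃ q ∈ P, IsUnit q ∧ f * q = p}
  mul_mem' := by
    rintro f f' ⟨p, hp, q, hq, hu, h⟩ ⟨p', hp', q', hq', hu', h'⟩
    exact ⟨p * p', mul_mem hp hp', q * q', mul_mem hq hq', hu.mul hu', by rw [← h, ← h']; ring⟩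
  add_mem' := by
    rintro f f' ⟨p, hp, q, hq, hu, h⟩ ⟨p', hp', q', hq', hu', h'⟩
    exact ⟨p * q' + p' * q, add_mem (mul_mem hp hq') (mul_mem hp' hq), q * q', mul_mem hq hq',
      hu.mul hu', by rw [← h, ← h']; ring⟩
  algebraMap_mem' r := ⟨algebraMap ℝ 𝓐 r, P.algebraMap_mem r, 1, P.one_mem, isUnit_one, mul_one _⟩

theorem le_fractions (P : Subalgebra ℝ 𝓐) : P ≤ fractions P :=
  fun p hp => ⟨p, hp, 1, P.one_mem, isUnit_one, mul_one _⟩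

theorem derivation_mem_fractions {P : Subalgebra ℝ 𝓐} {D : Derivation ℝ 𝓐 𝓐}
    (hD : ∀ f ∈ P, D f ∈ P) {f : 𝓐} (hf : f ∈ fractions P) : D f ∈ fractions P := by
  obtain ⟨p, hp, q, hq, hu, h⟩ := hf
  refine ⟨D p * q - p * D q, sub_mem (mul_mem (hD p hp) hq) (mul_mem hp (hD q hq)), q * q,
    mul_mem hq hq, hu.mul hu, ?_⟩
  rw [← h, Derivation.leibniz, smul_eq_mul, smul_eq_mul]
  ring

theorem inv_mem_fractions {P : Subalgebra ℝ 𝓐} {f g : 𝓐} (hf : f ∈ fractions P)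
    (hfg : f * g = 1) : g ∈ fractions P := by
  obtain ⟨p, hp, q, hq, hu, h⟩ := hf
  refine ⟨q, hq, p, hp, ?_, ?_⟩
  · rw [← h]; exact (IsUnit.of_mul_eq_one g hfg).mul hu
  · rw [← h]; linear_combination q * hfg

/-- The determinant of `r` is a fraction, and a unit, so its inverse is a fraction as well. Thus `r`
is already invertible over the subalgebra of fractions, and inverses are unique. -/
theorem matrix_inv_mem_fractions {ι : Type*} [Fintype ι] [DecidableEq ι] {P : Subalgebra ℝ 𝓐}
    {r s : Matrix ι ι 𝓐} (hr : ∀ i j, r i j ∈ fractions P) (hsr : s * r = 1) (i j : ι) :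
    s i j ∈ fractions P := by
  set r' : Matrix ι ι (fractions P) := Matrix.of fun i j => ⟨r i j, hr i j⟩
  have hmap : (fractions P).val.toRingHom.mapMatrix r' = r := by ext; rfl
  have hdet : (r'.det : 𝓐) = r.det := by
    rw [← hmap]
    exact RingHom.map_det (fractions P).val.toRingHom r'
  have hd : r.det * s.det = 1 := by rw [mul_comm, ← Matrix.det_mul, hsr, Matrix.det_one]
  have hs : s.det ∈ fractions P := inv_mem_fractions (hdet ▸ r'.det.2) hd
  have hunit : IsUnit r'.det := IsUnit.of_mul_eq_one ⟨s.det, hs⟩ (Subtype.ext (by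
    rw [MulMemClass.coe_mul, hdet]; exact hd))
  have h1 : r' * r'⁻¹ = 1 := Matrix.mul_nonsing_inv _ hunit
  have h2 := congrArg (fractions P).val.toRingHom.mapMatrix h1
  rw [map_mul, hmap, map_one] at h2
  have h3 : s = (fractions P).val.toRingHom.mapMatrix r'⁻¹ := by
    calc s = s * (r * (fractions P).val.toRingHom.mapMatrix r'⁻¹) := by rw [h2, mul_one]
      _ = _ := by rw [← mul_assoc, hsr, one_mul]
  rw [h3]
  exact (r'⁻¹ i j).2

end Fractions

/-! ### Rationality of the spray and curvature of a root metric -/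

namespace TangentCalculus.IsGeodesicSpray

variable {ι 𝓐 : Type*} [Fintype ι] [DecidableEq ι] [CommRing 𝓐] [Algebra ℝ 𝓐]
variable {T : TangentCalculus ι 𝓐} {Φ : 𝓐} {S : Matrix ι ι 𝓐} {G : ι → 𝓐}
  (h : IsGeodesicSpray T Φ S G) {P : Subalgebra ℝ 𝓐}
  (hX : ∀ i, ∀ f ∈ P, T.X i f ∈ P) (hY : ∀ i, ∀ f ∈ P, T.Y i f ∈ P) (hy : ∀ i, T.y i ∈ P)
  {l : ℕ} (hl : l ≠ 0) (hΦ : IsUnit Φ) (hA : Φ ^ l ∈ P)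

include hl hΦ hA in
-- Here `ρ = D(Φ ^ l) / (l Φ ^ l)`. Only the power `Φ ^ l` is assumed to lie in `P`, so `Φ` itself
-- need not be a fraction.
theorem logDeriv_mem_fractions {D : Derivation ℝ 𝓐 𝓐} (hD : ∀ f ∈ P, D f ∈ P) :
    ∃ ρ ∈ fractions P, D Φ = Φ * ρ := by
  obtain ⟨u, hu⟩ := hΦ
  refine ⟨D Φ * ↑u⁻¹, ?_, ?_⟩
  · refine ⟨D (Φ ^ l), hD _ hA, algebraMap ℝ 𝓐 l * Φ ^ l, mul_mem (P.algebraMap_mem _) hA, ?_, ?_⟩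
    · refine IsUnit.mul ?_ ((hu ▸ u.isUnit).pow l)
      exact (IsUnit.mk0 (l : ℝ) (Nat.cast_ne_zero.2 hl)).map _
    · obtain ⟨k, rfl⟩ := Nat.exists_eq_succ_of_ne_zero hl
      rw [Derivation.leibniz_pow, map_natCast]
      have : (↑u⁻¹ : 𝓐) * Φ = 1 := by rw [← hu]; exact u.inv_mul
      simp only [Nat.succ_eq_add_one, Nat.add_sub_cancel, nsmul_eq_mul, smul_eq_mul]
      push_cast
      linear_combination (D Φ * (k + 1) * Φ ^ k) * this
  · have : Φ * (↑u⁻¹ : 𝓐) = 1 := by rw [← hu]; exact u.mul_inv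
    linear_combination (-D Φ) * this

include h hX hY hy hl hΦ hA

/-- The Hessian is `Φ` times a matrix `r` of fractions, and the right side of the spray equation is
`Φ` times a vector `w` of fractions. The possibly irrational factor `Φ` cancels. -/
theorem spray_mem_fractions (i : ι) : G i ∈ fractions P := by
  choose ρ hρ hρ' using fun i => logDeriv_mem_fractions hl hΦ hA (hY i)
  choose τ hτ hτ' using fun i => logDeriv_mem_fractions hl hΦ hA (hX i)
  have hYf (i : ι) {f : 𝓐} : f ∈ fractions P → T.Y i f ∈ fractions P :=
    derivation_mem_fractions (hY i)
  have hXf (i : ι) {f : 𝓐} : f ∈ fractions P → T.X i f ∈ fractions P :=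
    derivation_mem_fractions (hX i)
  set r : Matrix ι ι 𝓐 := Matrix.of fun k i => ρ k * ρ i + T.Y k (ρ i) with hr
  have hYY (k i : ι) : T.Y k (T.Y i Φ) = Φ * r k i := by
    simp only [hρ', Derivation.leibniz, smul_eq_mul, hr, Matrix.of_apply]; ring
  have hXY (q k : ι) : T.X q (T.Y k Φ) = Φ * (τ q * ρ k + T.X q (ρ k)) := by
    simp only [hρ', hτ', Derivation.leibniz, smul_eq_mul]; ring
  have hSr : (Φ • S) * r = 1 := by
    rw [← h.inv_mul, Matrix.smul_mul, ← Matrix.mul_smul]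
    congr 1
    ext k i
    simp [hYY]
  have hS := matrix_inv_mem_fractions (P := P) (r := r) (s := Φ • S)
    (fun k i => add_mem (mul_mem (hρ k) (hρ i)) (hYf k (hρ i))) hSr
  set w : ι → 𝓐 := fun k => ∑ q, T.y q * (τ q * ρ k + T.X q (ρ k)) - τ k with hw
  have hwm (k : ι) : w k ∈ fractions P := by
    refine sub_mem (sum_mem fun q _ => mul_mem (le_fractions P (hy q)) ?_) (hτ k)
    exact add_mem (mul_mem (hτ q) (hρ k)) (hXf q (hρ k))
  have hrG : r.mulVec G = fun k => algebraMap ℝ 𝓐 (1 / 2) * w k := by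
    funext k
    have h1 := h.spray k
    have h2 : Φ * (2 * r.mulVec G k) = Φ * w k := by
      have e1 : ∑ i, T.Y k (T.Y i Φ) * G i = Φ * r.mulVec G k := by
        simp only [Matrix.mulVec, dotProduct, Finset.mul_sum, hYY, mul_assoc]
      have e2 : ∑ q, T.y q * T.X q (T.Y k Φ)
          = Φ * ∑ q, T.y q * (τ q * ρ k + T.X q (ρ k)) := by
        rw [Finset.mul_sum]
        exact Finset.sum_congr rfl fun q _ => by rw [hXY]; ring
      rw [e1, e2, hτ'] at h1
      rw [hw]
      linear_combination h1
    have h3 := hΦ.mul_left_cancel h2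
    have h4 : algebraMap ℝ 𝓐 (1 / 2) * 2 = 1 := by
      rw [← map_ofNat (algebraMap ℝ 𝓐), ← map_mul]; norm_num
    linear_combination algebraMap ℝ 𝓐 (1 / 2) * h3 - r.mulVec G k * h4
  have hG := congrArg (Φ • S).mulVec hrG
  rw [Matrix.mulVec_mulVec, hSr, Matrix.one_mulVec] at hG
  rw [hG]
  exact sum_mem fun k _ => mul_mem (hS i k) (mul_mem (Subalgebra.algebraMap_mem _ _) (hwm k))

theorem riem_mem_fractions (i k : ι) : T.riem G i k ∈ fractions P := by
  have hG := h.spray_mem_fractions hX hY hy hl hΦ hA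
  have hYf (i : ι) {f : 𝓐} : f ∈ fractions P → T.Y i f ∈ fractions P :=
    derivation_mem_fractions (hY i)
  have hXf (i : ι) {f : 𝓐} : f ∈ fractions P → T.X i f ∈ fractions P :=
    derivation_mem_fractions (hX i)
  have h2 : (2 : 𝓐) ∈ fractions P := by simp
  refine sub_mem (add_mem (sub_mem (mul_mem h2 (hXf _ (hG _))) (sum_mem fun j _ => ?_))
    (mul_mem h2 (sum_mem fun j _ => ?_))) (sum_mem fun j _ => ?_)
  · exact mul_mem (le_fractions P (hy j)) (hXf _ (hYf _ (hG _)))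
  · exact mul_mem (hG _) (hYf _ (hYf _ (hG _)))
  · exact mul_mem (hYf _ (hG _)) (hYf _ (hG _))

end TangentCalculus.IsGeodesicSpray

open TopologicalSpace

/-! ### Smooth functions on an open set, with directional derivatives as derivations -/

section SmoothAlgebra

variable {E : Type*} [NormedAddCommGroup E] [NormedSpace ℝ E]

/-- The algebra of smooth real functions on an open subset of a normed space. -/
def smoothAlgebra (Ω : Opens E) : Subalgebra ℝ (Ω → ℝ) where
  carrier := {f | ∃ F : E → ℝ, ContDiffOn ℝ ∞ F Ω ∧ ∀ p : Ω, F p = f p}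
  mul_mem' := by
    rintro f g ⟨F, hF, hf⟩ ⟨H, hH, hg⟩
    exact ⟨fun p => F p * H p, hF.mul hH, fun p => by simp [hf, hg]⟩
  add_mem' := by
    rintro f g ⟨F, hF, hf⟩ ⟨H, hH, hg⟩
    exact ⟨fun p => F p + H p, hF.add hH, fun p => by simp [hf, hg]⟩
  algebraMap_mem' r := ⟨fun _ => r, contDiffOn_const, fun _ => rfl⟩

namespace smoothAlgebra

variable {Ω : Opens E}

/-- Extension by zero. -/
def extend (f : smoothAlgebra Ω) : E → ℝ := Function.extend Subtype.val f.1 0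

theorem extend_apply (f : smoothAlgebra Ω) (p : Ω) : extend f p = f.1 p :=
  Subtype.val_injective.extend_apply _ _ _

theorem contDiffOn_extend (f : smoothAlgebra Ω) : ContDiffOn ℝ ∞ (extend f) Ω := by
  obtain ⟨F, hF, h⟩ := f.2
  exact hF.congr fun p hp => (extend_apply f ⟨p, hp⟩).trans (h ⟨p, hp⟩).symm

theorem contDiffAt_extend (f : smoothAlgebra Ω) (p : Ω) : ContDiffAt ℝ ∞ (extend f) p :=
  (contDiffOn_extend f).contDiffAt (Ω.2.mem_nhds p.2)

theorem differentiableAt_extend (f : smoothAlgebra Ω) (p : Ω) :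
    DifferentiableAt ℝ (extend f) p :=
  (contDiffAt_extend f p).differentiableAt (by simp)

theorem extend_eventuallyEq {f : smoothAlgebra Ω} {F : E → ℝ} (h : ∀ p : Ω, F p = f.1 p) (p : Ω) :
    F =ᶠ[nhds (p : E)] extend f := by
  filter_upwards [Ω.2.mem_nhds p.2] with q hq
  rw [h ⟨q, hq⟩, ← extend_apply]

/-- A smooth function on `Ω` as an element of the algebra. -/
def ofContDiffOn (F : E → ℝ) (hF : ContDiffOn ℝ ∞ F Ω) : smoothAlgebra Ω :=
  ⟨fun p => F p, F, hF, fun _ => rfl⟩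

/-- The derivation given by the directional derivative along a fixed vector. -/
def dirDeriv (v : E) : Derivation ℝ (smoothAlgebra Ω) (smoothAlgebra Ω) :=
  Derivation.mk'
    { toFun := fun f => ofContDiffOn (fun p => fderiv ℝ (extend f) p v)
        (((contDiffOn_extend f).fderiv_of_isOpen Ω.2 (m := ∞) (by simp)).clm_apply contDiffOn_const)
      map_add' := fun f g => by
        apply Subtype.ext
        funext p
        change fderiv ℝ (extend (f + g)) p v = fderiv ℝ (extend f) p v + fderiv ℝ (extend g) p v
        have h : (fun q => extend f q + extend g q) =ᶠ[nhds (p : E)] extend (f + g) :=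
          extend_eventuallyEq (fun q => by simp [extend_apply]) p
        rw [← h.fderiv_eq, fderiv_fun_add (differentiableAt_extend f p) (differentiableAt_extend g p)]
        rfl
      map_smul' := fun c f => by
        apply Subtype.ext
        funext p
        change fderiv ℝ (extend (c • f)) p v = c * fderiv ℝ (extend f) p v
        have h : (fun q => c * extend f q) =ᶠ[nhds (p : E)] extend (c • f) :=
          extend_eventuallyEq (fun q => by simp [extend_apply]) p
        rw [← h.fderiv_eq, fderiv_const_mul (differentiableAt_extend f p)]
        rfl }
    fun f g => by
      apply Subtype.ext
      funext p
      change fderiv ℝ (extend (f * g)) p v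
        = f.1 p * fderiv ℝ (extend g) p v + g.1 p * fderiv ℝ (extend f) p v
      have h : (fun q => extend f q * extend g q) =ᶠ[nhds (p : E)] extend (f * g) :=
        extend_eventuallyEq (fun q => by simp [extend_apply]) p
      rw [← h.fderiv_eq, fderiv_fun_mul (differentiableAt_extend f p) (differentiableAt_extend g p),
        extend_apply, extend_apply]
      rfl

theorem dirDeriv_apply (v : E) (f : smoothAlgebra Ω) (p : Ω) :
    (dirDeriv v f).1 p = fderiv ℝ (extend f) p v := rfl

theorem dirDeriv_apply_of_eq (v : E) {f : smoothAlgebra Ω} {F : E → ℝ} (h : ∀ p : Ω, F p = f.1 p)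
    (p : Ω) : (dirDeriv v f).1 p = fderiv ℝ F p v := by
  rw [dirDeriv_apply, (extend_eventuallyEq h p).fderiv_eq]

theorem dirDeriv_comm (v w : E) (f : smoothAlgebra Ω) :
    dirDeriv v (dirDeriv w f) = dirDeriv w (dirDeriv v f) := by
  have key (v w : E) (p : Ω) : (dirDeriv v (dirDeriv w f)).1 p
      = fderiv ℝ (fderiv ℝ (extend f)) p v w := by
    rw [dirDeriv_apply_of_eq v (F := fun p => fderiv ℝ (extend f) p w) (fun _ => rfl)]
    have hd : DifferentiableAt ℝ (fderiv ℝ (extend f)) p :=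
      ((contDiffAt_extend f p).fderiv_right (m := 1) (by norm_cast)).differentiableAt (by simp)
    rw [fderiv_clm_apply hd (differentiableAt_const w)]
    simp
  apply Subtype.ext
  funext p
  rw [key, key]
  exact ((contDiffAt_extend f p).isSymmSndFDerivAt (by simp; exact WithTop.coe_le_coe.2 le_top)) v w

theorem isUnit_of_ne_zero {f : smoothAlgebra Ω} (h : ∀ p, f.1 p ≠ 0) : IsUnit f := by
  refine IsUnit.of_mul_eq_one (ofContDiffOn (fun p => (extend f p)⁻¹) ?_) ?_
  · exact (contDiffOn_extend f).inv fun p hp => by rw [extend_apply f ⟨p, hp⟩]; exact h _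
  · apply Subtype.ext
    funext p
    change f.1 p * (extend f p)⁻¹ = 1
    rw [extend_apply, mul_inv_cancel₀ (h p)]

theorem ne_zero_of_isUnit {f : smoothAlgebra Ω} (h : IsUnit f) (p : Ω) : f.1 p ≠ 0 := by
  obtain ⟨g, hg⟩ := h.exists_right_inv
  have : f.1 p * g.1 p = 1 := congrFun (congrArg Subtype.val hg) p
  exact left_ne_zero_of_mul_eq_one this

/-- Evaluation at a point. -/
def evalAt (p : Ω) : smoothAlgebra Ω →+* ℝ :=
  (Pi.evalRingHom (fun _ : Ω => ℝ) p).comp (smoothAlgebra Ω).val.toRingHom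

theorem eval_apply (p : Ω) (f : smoothAlgebra Ω) : evalAt p f = f.1 p := rfl

theorem ext_eval {f g : smoothAlgebra Ω} (h : ∀ p, evalAt p f = evalAt p g) : f = g :=
  Subtype.ext (funext h)

end smoothAlgebra

end SmoothAlgebra

/-! ### The slit tangent bundle as a model of the formal calculus -/

section Slit

variable {n : ℕ}

/-- The slit tangent bundle `U × (ℝⁿ ∖ {0})` of an open set `U ⊆ ℝⁿ`. -/
def slit (U : Opens (Coord n)) : Opens (Coord n × Coord n) :=
  ⟨(U : Set (Coord n)) ×ˢ {0}ᶜ, U.2.prod isOpen_compl_singleton⟩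

variable {U : Opens (Coord n)}

open smoothAlgebra

/-- The fibre coordinate `y^i`. -/
def fibreCoord (U : Opens (Coord n)) (i : Fin n) : smoothAlgebra (slit U) :=
  ofContDiffOn (fun p => p.2 i) (by fun_prop)

/-- The fibre coordinate `y^j` as a linear form on `ℝⁿ × ℝⁿ`. -/
def fibreProj (j : Fin n) : Coord n × Coord n →L[ℝ] ℝ :=
  (EuclideanSpace.proj j).comp (ContinuousLinearMap.snd ℝ (Coord n) (Coord n))

/-- The calculus of smooth functions on the slit tangent bundle of an open subset of `ℝⁿ`. -/
def slitCalculus (U : Opens (Coord n)) : TangentCalculus (Fin n) (smoothAlgebra (slit U)) where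
  X i := dirDeriv (EuclideanSpace.single i 1, 0)
  Y i := dirDeriv (0, EuclideanSpace.single i 1)
  y i := fibreCoord U i
  X_comm _ _ _ := dirDeriv_comm _ _ _
  XY_comm _ _ _ := dirDeriv_comm _ _ _
  Y_comm _ _ _ := dirDeriv_comm _ _ _
  X_y i j := by
    apply Subtype.ext
    funext p
    rw [dirDeriv_apply_of_eq _ (F := fibreProj j) (fun _ => rfl), ContinuousLinearMap.fderiv]
    simp [fibreProj]
  Y_y i j := by
    apply Subtype.ext
    funext p
    rw [dirDeriv_apply_of_eq _ (F := fibreProj j) (fun _ => rfl), ContinuousLinearMap.fderiv]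
    split_ifs with h
    · simp [fibreProj, h]
    · simp [fibreProj, Ne.symm h]

/-- `f` is a coordinate expression of the element `a` of the algebra of smooth functions. -/
def Represents (f : Coord n → Coord n → ℝ) (a : smoothAlgebra (slit U)) : Prop :=
  ∀ p : slit U, f p.1.1 p.1.2 = evalAt p a

theorem Represents.hasFDerivAt {f : Coord n → Coord n → ℝ} {a : smoothAlgebra (slit U)}
    (h : Represents f a) (p : slit U) :
    HasFDerivAt (fun q : Coord n × Coord n => f q.1 q.2) (fderiv ℝ (extend a) p) p.1 :=
  (differentiableAt_extend a p).hasFDerivAt.congr_of_eventuallyEq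
    (extend_eventuallyEq (F := fun q : Coord n × Coord n => f q.1 q.2) h p)

theorem Represents.dx {f : Coord n → Coord n → ℝ} {a : smoothAlgebra (slit U)}
    (h : Represents f a) (k : Fin n) : Represents (dx k f) ((slitCalculus U).X k a) := by
  intro p
  have h1 : HasFDerivAt (fun x : Coord n => (x, p.1.2)) (ContinuousLinearMap.inl ℝ (Coord n) (Coord n))
    p.1.1 := hasFDerivAt_prodMk_left _ _
  have h2 := (HasFDerivAt.comp (f := fun x : Coord n => (x, p.1.2))
    (g := fun q : Coord n × Coord n => f q.1 q.2) p.1.1 (h.hasFDerivAt p) h1).fderiv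
  change fderiv ℝ ((fun q : Coord n × Coord n => f q.1 q.2) ∘ fun x : Coord n => (x, p.1.2)) p.1.1 _ = _
  rw [h2]
  rfl

theorem Represents.dy {f : Coord n → Coord n → ℝ} {a : smoothAlgebra (slit U)}
    (h : Represents f a) (k : Fin n) : Represents (dy k f) ((slitCalculus U).Y k a) := by
  intro p
  have h1 : HasFDerivAt (fun y : Coord n => (p.1.1, y)) (ContinuousLinearMap.inr ℝ (Coord n) (Coord n))
    p.1.2 := hasFDerivAt_prodMk_right _ _
  have h2 := (HasFDerivAt.comp (f := fun y : Coord n => (p.1.1, y))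
    (g := fun q : Coord n × Coord n => f q.1 q.2) p.1.2 (h.hasFDerivAt p) h1).fderiv
  change fderiv ℝ ((fun q : Coord n × Coord n => f q.1 q.2) ∘ fun y : Coord n => (p.1.1, y)) p.1.2 _ = _
  rw [h2]
  rfl

end Slit

open smoothAlgebra

variable {n : ℕ}

theorem natCast_mul_algebraMap_inv {𝓐 : Type*} [CommRing 𝓐] [Algebra ℝ 𝓐] (k : ℕ) [NeZero k] :
    (k : 𝓐) * algebraMap ℝ 𝓐 (1 / k) = 1 := by
  rw [← map_natCast (algebraMap ℝ 𝓐), ← map_mul,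
    mul_one_div_cancel (Nat.cast_ne_zero.2 (NeZero.ne k)), map_one]

theorem two_mul_half {𝓐 : Type*} [CommRing 𝓐] [Algebra ℝ 𝓐] :
    2 * algebraMap ℝ 𝓐 (1 / 2) = 1 := natCast_mul_algebraMap_inv 2

theorem four_mul_quarter {𝓐 : Type*} [CommRing 𝓐] [Algebra ℝ 𝓐] :
    4 * algebraMap ℝ 𝓐 (1 / 4) = 1 := natCast_mul_algebraMap_inv 4

/-! ### The coordinate formula for the spray -/

namespace TangentCalculus

variable {ι 𝓐 : Type*} [Fintype ι] [DecidableEq ι] [CommRing 𝓐] [Algebra ℝ 𝓐]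
  (T : TangentCalculus ι 𝓐)

/-- The coefficients `¼ g^{ik} (2 ∂g_{pk}/∂x^q - ∂g_{pq}/∂x^k) y^p y^q`. -/
def sprayOf (g : Matrix ι ι 𝓐) (i : ι) : 𝓐 :=
  algebraMap ℝ _ (1 / 4) * ∑ k, ∑ p, ∑ q, g⁻¹ i k *
    (2 * T.X q (g p k) - T.X k (g p q)) * T.y p * T.y q

variable {T} {Φ : 𝓐} {g : Matrix ι ι 𝓐} (hΦ : T.liouville Φ = 2 * Φ)
  (hg : ∀ i j, T.Y i (T.Y j Φ) = 2 * g i j)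
include hΦ hg

theorem two_mul_sum_mul_y (k : ι) : 2 * ∑ p, g p k * T.y p = T.Y k Φ := by
  rw [← liouville_Y_of_homog hΦ, liouville_apply, Finset.mul_sum]
  refine Finset.sum_congr rfl fun p _ => ?_
  rw [hg]; ring

/-- The Hessian is `2 g`, hence the inverse `½ g⁻¹`. After lowering the index, Euler's relations `2
g_{pk} y^p = ∂Φ/∂y^k` and `g_{pq} y^p y^q = Φ` reduce the Christoffel expression to Euler–Lagrange
form. -/
theorem isGeodesicSpray_sprayOf (hdet : IsUnit g.det) :
    T.IsGeodesicSpray Φ (algebraMap ℝ 𝓐 (1 / 2) • g⁻¹) (T.sprayOf g) where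
  homog := hΦ
  inv_mul := by
    have : (Matrix.of fun k i => T.Y k (T.Y i Φ)) = (2 : 𝓐) • g := by
      ext1 k i
      simp [hg]
    rw [this, Matrix.smul_mul, Matrix.mul_smul, smul_smul, mul_comm, two_mul_half, one_smul,
      Matrix.nonsing_inv_mul _ hdet]
  spray k := by
    set w : ι → 𝓐 := fun k => ∑ p, ∑ q,
      (2 * T.X q (g p k) - T.X k (g p q)) * T.y p * T.y q with hw
    have hG : T.sprayOf g = algebraMap ℝ 𝓐 (1 / 4) • g⁻¹.mulVec w := by
      funext i
      simp only [sprayOf, Pi.smul_apply, smul_eq_mul, Matrix.mulVec, dotProduct, hw,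
        Finset.mul_sum, mul_assoc]
    have hgG : g.mulVec (T.sprayOf g) = algebraMap ℝ 𝓐 (1 / 4) • w := by
      rw [hG, Matrix.mulVec_smul, Matrix.mulVec_mulVec,
        Matrix.mul_nonsing_inv _ hdet, Matrix.one_mulVec]
    have h1 : ∑ i, T.Y k (T.Y i Φ) * T.sprayOf g i = 2 * g.mulVec (T.sprayOf g) k := by
      simp only [Matrix.mulVec, dotProduct, Finset.mul_sum, hg, mul_assoc]
    have h2 (q : ι) : T.X q (T.Y k Φ) = 2 * ∑ p, T.X q (g p k) * T.y p := by
      rw [← two_mul_sum_mul_y hΦ hg, two_mul, map_add, map_sum, ← two_mul]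
      congr 1
      refine Finset.sum_congr rfl fun p _ => ?_
      rw [Derivation.leibniz, T.X_y, smul_eq_mul, smul_eq_mul]
      ring
    have h3 : ∑ p, ∑ q, T.X k (g p q) * T.y p * T.y q = T.X k Φ := by
      have h4 : ∑ q, ∑ p, g p q * T.y p * T.y q = Φ := by
        apply natCast_mul_cancel 2
        push_cast
        rw [← hΦ, liouville_apply, Finset.mul_sum]
        refine Finset.sum_congr rfl fun q _ => ?_
        rw [← two_mul_sum_mul_y hΦ hg q, ← Finset.sum_mul]
        ring
      rw [Finset.sum_comm]
      conv_rhs => rw [← h4]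
      simp only [map_sum, Derivation.leibniz, T.X_y, smul_eq_mul]
      exact Finset.sum_congr rfl fun q _ => Finset.sum_congr rfl fun p _ => by ring
    have h5 : w k = ∑ q, T.y q * T.X q (T.Y k Φ) - T.X k Φ := by
      rw [← h3, hw]
      simp only [h2, sub_mul, Finset.sum_sub_distrib]
      congr 1
      rw [Finset.sum_comm]
      refine Finset.sum_congr rfl fun q _ => ?_
      rw [Finset.mul_sum, Finset.mul_sum]
      exact Finset.sum_congr rfl fun p _ => by ring
    rw [h1, hgG, ← h5, Pi.smul_apply, smul_eq_mul]
    linear_combination w k * four_mul_quarter (𝓐 := 𝓐)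

end TangentCalculus

theorem sum_coord_mul_single (L : Coord n →L[ℝ] ℝ) (u : Coord n) :
    ∑ i, u i * L (EuclideanSpace.single i 1) = L u := by
  conv_rhs => rw [← (EuclideanSpace.basisFun (Fin n) ℝ).sum_repr u]
  simp [map_sum]

section

variable {U : Opens (Coord n)} {f : Coord n → Coord n → ℝ} {a : smoothAlgebra (slit U)}

theorem Represents.differentiableAt_fibre (h : Represents f a) {x y : Coord n} (hx : x ∈ U)
    (hy : y ≠ 0) : DifferentiableAt ℝ (f x) y :=
  ((h.hasFDerivAt ⟨(x, y), hx, hy⟩).comp (f := fun y : Coord n => (x, y)) y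
    (hasFDerivAt_prodMk_right x y)).differentiableAt

theorem Represents.deriv_line (h : Represents f a) {x y : Coord n} (hx : x ∈ U)
    (hy : y ≠ 0) (u : Coord n) : deriv (fun t : ℝ => f x (y + t • u)) 0 = ∑ i, u i * Finsler.dy i f x y := by
  have := (h.differentiableAt_fibre hx hy).lineDeriv_eq_fderiv (v := u)
  rw [lineDeriv] at this
  rw [this, ← sum_coord_mul_single]
  rfl

theorem Represents.deriv_deriv_line (h : Represents f a) {x y : Coord n} (hx : x ∈ U)
    (hy : y ≠ 0) (u v : Coord n) :
    deriv (fun s : ℝ => deriv (fun t : ℝ => f x (y + s • u + t • v)) 0) 0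
      = ∑ j, v j * ∑ i, u i * Finsler.dy i (Finsler.dy j f) x y := by
  -- The inner derivative is known only while `y + s u ≠ 0`, which holds for `s` near 0.
  have hev : (fun s : ℝ => deriv (fun t : ℝ => f x (y + s • u + t • v)) 0)
      =ᶠ[nhds 0] fun s => ∑ j, v j * Finsler.dy j f x (y + s • u) := by
    have hc : ContinuousAt (fun s : ℝ => y + s • u) 0 := by fun_prop
    have hne : ∀ᶠ s : ℝ in nhds 0, y + s • u ≠ 0 := hc.eventually_ne (by simpa using hy)
    filter_upwards [hne] with s hs
    exact h.deriv_line hx hs v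
  rw [hev.deriv_eq]
  have hd (j : Fin n) : DifferentiableAt ℝ (fun s : ℝ => Finsler.dy j f x (y + s • u)) 0 := by
    have h1 := (h.dy j).differentiableAt_fibre hx hy
    have h2 : DifferentiableAt ℝ (fun s : ℝ => y + s • u) 0 := by fun_prop
    exact DifferentiableAt.comp (0 : ℝ) (by simpa using h1) h2
  rw [deriv_fun_sum fun j _ => (hd j).const_mul _]
  refine Finset.sum_congr rfl fun j _ => ?_
  rw [deriv_const_mul_field, (h.dy j).deriv_line hx hy]

end

/-! ### Finsler metrics on open subsets of coordinate space -/

/-- `F` is a Finsler metric on the open subset `U` of `ℝⁿ`. -/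
structure IsLocalFinsler (U : Opens (Coord n)) (F : Coord n → Coord n → ℝ) : Prop where
  smooth : ContDiffOn ℝ ∞ (fun p : Coord n × Coord n => F p.1 p.2) (slit U)
  pos : ∀ x ∈ U, ∀ y, y ≠ 0 → 0 < F x y
  homog : ∀ x ∈ U, ∀ y, ∀ c : ℝ, 0 ≤ c → F x (c • y) = c * F x y
  posDef : ∀ x ∈ U, ∀ y u, y ≠ 0 → u ≠ 0 →
    0 < deriv (fun s : ℝ => deriv (fun t : ℝ => F x (y + s • u + t • u) ^ 2) 0) 0

namespace IsLocalFinsler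

variable {U : Opens (Coord n)} {F : Coord n → Coord n → ℝ} (h : IsLocalFinsler U F)

/-- The square `F²` as a smooth function. -/
def sq : smoothAlgebra (slit U) :=
  ofContDiffOn (fun p : Coord n × Coord n => F p.1 p.2 ^ 2) (h.smooth.pow 2)

theorem represents_sq : Represents (fun x y => F x y ^ 2) h.sq := fun _ => rfl

/-- The fundamental tensor as a matrix of smooth functions. -/
def metric : Matrix (Fin n) (Fin n) (smoothAlgebra (slit U)) :=
  Matrix.of fun i j => algebraMap ℝ _ (1 / 2) *
    (slitCalculus U).Y i ((slitCalculus U).Y j h.sq)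

theorem eval_algebraMap (p : slit U) (c : ℝ) :
    evalAt p (algebraMap ℝ (smoothAlgebra (slit U)) c) = c := rfl

theorem represents_metric (i j : Fin n) : Represents (gLow F i j) (h.metric i j) := by
  intro p
  rw [metric, Matrix.of_apply, map_mul, eval_algebraMap, ← (h.represents_sq.dy j).dy i p]
  rfl

theorem metric_symm (i j : Fin n) : h.metric i j = h.metric j i := by
  simp only [metric, Matrix.of_apply]
  rw [(slitCalculus U).Y_comm]

include h in
theorem gLow_pos (p : slit U) {u : Coord n} (hu : u ≠ 0) :
    0 < ∑ j, u j * ∑ i, u i * gLow F i j p.1.1 p.1.2 := by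
  have h1 := h.posDef p.1.1 p.2.1 p.1.2 u p.2.2 hu
  rw [h.represents_sq.deriv_deriv_line p.2.1 p.2.2 u u] at h1
  have h2 : ∑ j, u j * ∑ i, u i * gLow F i j p.1.1 p.1.2 = (1 / 2) * ∑ j, u j * ∑ i, u i *
      Finsler.dy i (Finsler.dy j fun x y => F x y ^ 2) p.1.1 p.1.2 := by
    simp only [Finset.mul_sum, gLow]
    exact Finset.sum_congr rfl fun j _ => Finset.sum_congr rfl fun i _ => by ring
  rw [h2]
  positivity

include h in
theorem gLow_det_ne_zero (p : slit U) :
    (Matrix.of fun i j => gLow F i j p.1.1 p.1.2).det ≠ 0 := by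
  intro hdet
  obtain ⟨v, hv, hv0⟩ := Matrix.exists_vecMul_eq_zero_iff.2 hdet
  have h1 := h.gLow_pos p (u := WithLp.toLp 2 v) (by simpa using hv)
  have h2 : ∀ j, ∑ i, v i * gLow F i j p.1.1 p.1.2 = 0 := fun j => congrFun hv0 j
  simp [h2] at h1

theorem metric_map_eval (p : slit U) :
    (evalAt p).mapMatrix h.metric = Matrix.of fun i j => gLow F i j p.1.1 p.1.2 := by
  ext i j
  exact (h.represents_metric i j p).symm

theorem isUnit_metric_det : IsUnit h.metric.det := by
  refine isUnit_of_ne_zero fun p => ?_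
  rw [← eval_apply, RingHom.map_det, metric_map_eval]
  exact h.gLow_det_ne_zero p

theorem represents_metric_inv (i j : Fin n) : Represents (gUp F i j) (h.metric⁻¹ i j) := by
  intro p
  have h1 := congrArg (evalAt p).mapMatrix (Matrix.mul_nonsing_inv _ h.isUnit_metric_det)
  rw [map_mul, metric_map_eval, map_one] at h1
  rw [gUp, Matrix.inv_eq_right_inv h1]
  rfl

theorem eval_y (p : slit U) (i : Fin n) : evalAt p ((slitCalculus U).y i) = p.1.2 i := rfl

theorem represents_sprayOf (i : Fin n) : Represents (spray F i) ((slitCalculus U).sprayOf h.metric i) := by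
  intro p
  simp only [spray, TangentCalculus.sprayOf, map_mul, map_sum, map_sub, eval_algebraMap, eval_y, map_ofNat,
    h.represents_metric_inv i _ p, ((h.represents_metric _ _).dx _) p]

theorem represents_riem (i k : Fin n) :
    Represents (riemann F i k) ((slitCalculus U).riem ((slitCalculus U).sprayOf h.metric) i k) := by
  intro p
  have hG := h.represents_sprayOf
  simp only [riemann, TangentCalculus.riem, map_mul, map_sum, map_sub, map_add, eval_y, map_ofNat,
    fun i k => (hG i).dx k p, fun i k => (hG i).dy k p, fun i j k => ((hG i).dy j).dx k p,
    fun i j k => ((hG i).dy j).dy k p, fun i => hG i p]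

theorem liouville_sq : (slitCalculus U).liouville h.sq = 2 * h.sq := by
  refine ext_eval fun p => ?_
  rw [TangentCalculus.liouville_apply, map_sum]
  simp only [map_mul, eval_y, map_ofNat, ← h.represents_sq.dy _ p, ← h.represents_sq p]
  rw [← h.represents_sq.deriv_line p.2.1 p.2.2]
  have hev : (fun t : ℝ => F p.1.1 (p.1.2 + t • p.1.2) ^ 2)
      =ᶠ[nhds 0] fun t => (1 + t) ^ 2 * F p.1.1 p.1.2 ^ 2 := by
    filter_upwards [lt_mem_nhds (show (-1 : ℝ) < 0 by norm_num)] with t ht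
    have : p.1.2 + t • p.1.2 = (1 + t) • p.1.2 := by rw [add_smul, one_smul]
    rw [this, h.homog _ p.2.1 _ _ (by linarith), mul_pow]
  rw [hev.deriv_eq]
  have hd : HasDerivAt (fun t : ℝ => (1 + t) ^ 2 * F p.1.1 p.1.2 ^ 2)
      (2 * F p.1.1 p.1.2 ^ 2) 0 := by
    have h1 := (((hasDerivAt_id (0 : ℝ)).const_add 1).pow 2).mul_const (F p.1.1 p.1.2 ^ 2)
    exact h1.congr_deriv (by norm_num)
  exact hd.deriv

include h

theorem Y_Y_sq (i j : Fin n) :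
    (slitCalculus U).Y i ((slitCalculus U).Y j h.sq) = 2 * h.metric i j := by
  rw [metric, Matrix.of_apply, ← mul_assoc, two_mul_half, one_mul]

theorem two_mul_sum_metric_y (k : Fin n) :
    2 * ∑ p, h.metric p k * (slitCalculus U).y p = (slitCalculus U).Y k h.sq :=
  TangentCalculus.two_mul_sum_mul_y h.liouville_sq h.Y_Y_sq k

theorem isGeodesicSpray : (slitCalculus U).IsGeodesicSpray h.sq
    (algebraMap ℝ (smoothAlgebra (slit U)) (1 / 2) • h.metric⁻¹)
    ((slitCalculus U).sprayOf h.metric) :=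
  TangentCalculus.isGeodesicSpray_sprayOf h.liouville_sq h.Y_Y_sq h.isUnit_metric_det

theorem two_mul_yLow (p : slit U) (k : Fin n) :
    2 * yLow F k p.1.1 p.1.2 = evalAt p ((slitCalculus U).Y k h.sq) := by
  rw [← h.two_mul_sum_metric_y, map_mul, map_sum, map_ofNat, yLow]
  congr 1
  refine Finset.sum_congr rfl fun j _ => ?_
  rw [map_mul, h.metric_symm, ← h.represents_metric k j p, eval_y]

theorem sq_mul_angular (p : slit U) (i k : Fin n) :
    F p.1.1 p.1.2 ^ 2 * angular F i k p.1.1 p.1.2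
      = F p.1.1 p.1.2 ^ 2 * (if i = k then 1 else 0) - p.1.2 i * yLow F k p.1.1 p.1.2 := by
  have hF : F p.1.1 p.1.2 ≠ 0 := (h.pos _ p.2.1 _ p.2.2).ne'
  have hinv := Matrix.nonsing_inv_mul _ (h.gLow_det_ne_zero p).isUnit
  have h1 : ∑ j, gUp F i j p.1.1 p.1.2 * gLow F j k p.1.1 p.1.2 = if i = k then 1 else 0 := by
    have := congrFun (congrFun hinv i) k
    rwa [Matrix.mul_apply, Matrix.one_apply] at this
  have h2 : ∑ j, gUp F i j p.1.1 p.1.2 * yLow F j p.1.1 p.1.2 = p.1.2 i := by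
    have h3 : (Matrix.of fun a b => gLow F a b p.1.1 p.1.2)⁻¹.mulVec
        ((Matrix.of fun a b => gLow F a b p.1.1 p.1.2).mulVec p.1.2.ofLp) = p.1.2.ofLp := by
      rw [Matrix.mulVec_mulVec, hinv, Matrix.one_mulVec]
    exact congrFun h3 i
  rw [angular, ← h1]
  conv_rhs => rw [← h2]
  rw [Finset.mul_sum, Finset.mul_sum, Finset.sum_mul, ← Finset.sum_sub_distrib]
  refine Finset.sum_congr rfl fun j _ => ?_
  rw [angularLow]
  field_simp

theorem sum_y_mul_yLow (p : slit U) :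
    ∑ i, p.1.2 i * yLow F i p.1.1 p.1.2 = F p.1.1 p.1.2 ^ 2 := by
  have h1 := congrArg (evalAt p) h.liouville_sq
  rw [TangentCalculus.liouville_apply, map_sum] at h1
  simp only [map_mul, eval_y, map_ofNat, ← h.two_mul_yLow, ← h.represents_sq p] at h1
  have h2 : ∑ i, p.1.2 i * (2 * yLow F i p.1.1 p.1.2)
      = 2 * ∑ i, p.1.2 i * yLow F i p.1.1 p.1.2 := by
    rw [Finset.mul_sum]
    exact Finset.sum_congr rfl fun i _ => by ring
  linarith

/-- Multiplied by `F²` this reads `n F² - y^i y_i`, with `y^i y_i = F²`. It lets `K F²` be recovered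
from the trace of the curvature. -/
theorem sum_angular (p : slit U) : ∑ i, angular F i i p.1.1 p.1.2 = n - 1 := by
  have hF : F p.1.1 p.1.2 ^ 2 ≠ 0 := pow_ne_zero _ (h.pos _ p.2.1 _ p.2.2).ne'
  apply mul_left_cancel₀ hF
  rw [Finset.mul_sum]
  simp only [h.sq_mul_angular, if_true, Finset.sum_sub_distrib, h.sum_y_mul_yLow]
  simp
  ring

end IsLocalFinsler

/-! ### Reversible metrics have even curvature -/

section Parity

variable {U : Opens (Coord n)} {f g F : Coord n → Coord n → ℝ} {c d : ℝ}

/-- `f(x, -y) = c f(x, y)` over `U`. -/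
def HasParity (U : Opens (Coord n)) (c : ℝ) (f : Coord n → Coord n → ℝ) : Prop :=
  ∀ x ∈ U, ∀ y, f x (-y) = c * f x y

theorem HasParity.dx (h : HasParity U c f) (k : Fin n) : HasParity U c (Finsler.dx k f) := by
  intro x hx y
  have hev : (fun x => f x (-y)) =ᶠ[nhds x] c • fun x => f x y := by
    filter_upwards [U.2.mem_nhds hx] with z hz
    exact h z hz y
  simp only [Finsler.dx]
  rw [hev.fderiv_eq, fderiv_const_smul_field]
  rfl

/-- No differentiability is needed: `fderiv` commutes with scaling and with composition by a linear
equivalence even where it takes its default value. -/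
theorem HasParity.dy (h : HasParity U c f) (k : Fin n) : HasParity U (-c) (Finsler.dy k f) := by
  intro x hx y
  have h1 : f x ∘ (ContinuousLinearEquiv.neg ℝ   : Coord n ≃L[ℝ] Coord n) = c • f x :=
    funext (h x hx)
  have h2 := congrArg (fun φ => fderiv ℝ φ y (EuclideanSpace.single k 1)) h1
  simp only [ContinuousLinearEquiv.comp_right_fderiv] at h2
  rw [fderiv_const_smul_field] at h2
  change fderiv ℝ (f x) (-y) (-EuclideanSpace.single k 1) = _ at h2
  rw [map_neg] at h2
  change -(Finsler.dy k f x (-y)) = c * Finsler.dy k f x y at h2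
  linarith

variable (hF : HasParity U 1 F)
include hF

theorem hasParity_gLow (i j : Fin n) : HasParity U 1 (gLow F i j) := by
  have h2 : HasParity U 1 (fun x y => F x y ^ 2) := fun x hx y => by simp [hF x hx y]
  intro x hx y
  rw [gLow, gLow, ((h2.dy j).dy i) x hx y]
  ring

theorem hasParity_gUp (i j : Fin n) : HasParity U 1 (gUp F i j) := by
  intro x hx y
  rw [gUp, gUp]
  simp only [hasParity_gLow hF _ _ x hx y, one_mul]

theorem hasParity_spray (i : Fin n) : HasParity U 1 (spray F i) := by
  intro x hx y
  simp only [spray, hasParity_gUp hF _ _ x hx y, (hasParity_gLow hF _ _).dx _ x hx y, one_mul,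
    PiLp.neg_apply, mul_neg, neg_mul, neg_neg]

theorem hasParity_riemann (i k : Fin n) : HasParity U 1 (riemann F i k) := by
  intro x hx y
  have hG := hasParity_spray hF
  simp only [riemann, hG _ x hx y, (hG _).dx _ x hx y, ((hG _).dy _).dx _ x hx y,
    (hG _).dy _ x hx y, ((hG _).dy _).dy _ x hx y, one_mul, PiLp.neg_apply, neg_mul, mul_neg,
    neg_neg]

end Parity

namespace IsLocalFinsler

variable {U : Opens (Coord n)} {F K : Coord n → Coord n → ℝ} (h : IsLocalFinsler U F)
  (hK : ∀ x ∈ U, ∀ y, y ≠ 0 → ∀ i k, riemann F i k x y = K x y * F x y ^ 2 * angular F i k x y)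
include h hK

theorem sum_riemann {x y : Coord n} (hx : x ∈ U) (hy : y ≠ 0) :
    ∑ i, riemann F i i x y = K x y * F x y ^ 2 * (n - 1) := by
  simp only [hK x hx y hy, ← Finset.mul_sum, h.sum_angular ⟨(x, y), hx, hy⟩]

theorem flagCurvature_even (hn : 2 ≤ n) (hF : HasParity U 1 F) {x y : Coord n} (hx : x ∈ U)
    (hy : y ≠ 0) : K x (-y) = K x y := by
  have h1 := h.sum_riemann hK hx hy
  have h2 := h.sum_riemann hK hx (neg_ne_zero.2 hy)
  simp only [hasParity_riemann hF _ _ x hx y, hF x hx y, one_mul] at h2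
  rw [h1] at h2
  have hn' : (n : ℝ) - 1 ≠ 0 := by
    have : (2 : ℝ) ≤ n := by exact_mod_cast hn
    linarith
  exact (mul_right_cancel₀ (pow_ne_zero 2 (h.pos x hx y hy).ne') (mul_right_cancel₀ hn' h2)).symm

end IsLocalFinsler

/-! ### Schur's lemma in coordinates -/

section Schur

namespace IsLocalFinsler

variable {U : Opens (Coord n)} {F : Coord n → Coord n → ℝ} {s : Coord n → ℝ}
  (h : IsLocalFinsler U F)
  (hK : ∀ x ∈ U, ∀ y, y ≠ 0 → ∀ i k, riemann F i k x y = s x * F x y ^ 2 * angular F i k x y)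
include h hK

/-- No regularity of `s` is assumed; it is the trace of the smooth curvature divided by `(n - 1)
F²`. -/
theorem contDiffOn_flagCurvature (hn : 2 ≤ n) :
    ContDiffOn ℝ ∞ (fun p : Coord n × Coord n => s p.1) (slit U) := by
  have hn' : (n : ℝ) - 1 ≠ 0 := by
    have : (2 : ℝ) ≤ n := by exact_mod_cast hn
    linarith
  have h1 : ContDiffOn ℝ ∞ (fun p : Coord n × Coord n =>
      extend (∑ i, (slitCalculus U).riem ((slitCalculus U).sprayOf h.metric) i i) p
        / (F p.1 p.2 ^ 2 * (n - 1))) (slit U) :=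
    (contDiffOn_extend _).div ((h.smooth.pow 2).mul contDiffOn_const) fun p hp =>
      mul_ne_zero (pow_ne_zero 2 (h.pos p.1 hp.1 p.2 hp.2).ne') hn'
  refine h1.congr fun p hp => ?_
  have hF : F p.1 p.2 ≠ 0 := (h.pos p.1 hp.1 p.2 hp.2).ne'
  have h2 := h.sum_riemann (K := fun x _ => s x) hK hp.1 hp.2
  rw [extend_apply _ ⟨p, hp⟩, ← eval_apply, map_sum]
  simp only [← h.represents_riem _ _ ⟨p, hp⟩]
  rw [h2]
  field_simp

/-- The scalar function `σ(x)` as a smooth function on the slit tangent bundle. -/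
def scalarCurv (hn : 2 ≤ n) : smoothAlgebra (slit U) :=
  ofContDiffOn (fun p : Coord n × Coord n => s p.1) (h.contDiffOn_flagCurvature hK hn)

theorem represents_scalarCurv (hn : 2 ≤ n) :
    Represents (fun x _ => s x) (h.scalarCurv hK hn) := fun _ => rfl

theorem riem_eq_scalarCurv (hn : 2 ≤ n) (i k : Fin n) :
    2 * (slitCalculus U).riem ((slitCalculus U).sprayOf h.metric) i k
      = h.scalarCurv hK hn * (2 * h.sq * (if i = k then 1 else 0)
        - (slitCalculus U).y i * (slitCalculus U).Y k h.sq) := by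
  refine ext_eval fun p => ?_
  have hite : evalAt p (if i = k then 1 else 0) = if i = k then 1 else 0 := by
    split_ifs <;> simp
  simp only [map_mul, map_sub, map_ofNat, eval_y, ← h.two_mul_yLow, hite,
    ← h.represents_riem _ _ p, ← h.represents_sq p, ← h.represents_scalarCurv hK hn p,
    hK _ p.2.1 _ p.2.2]
  linear_combination 2 * s p.1.1 * h.sq_mul_angular p i k

theorem hasFDerivAt_scalarCurv (hn : 3 ≤ n) {x : Coord n} (hx : x ∈ U) : HasFDerivAt s (0 : Coord n →L[ℝ] ℝ) x := by
  have hrep := h.represents_scalarCurv hK (by omega : 2 ≤ n)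
  have hY (i : Fin n) : (slitCalculus U).Y i (h.scalarCurv hK (by omega)) = 0 := by
    refine ext_eval fun p => ?_
    rw [← hrep.dy i p]
    simp [Finsler.dy]
  have hX (i : Fin n) : (slitCalculus U).X i (h.scalarCurv hK (by omega)) = 0 :=
    h.isGeodesicSpray.X_eq_zero_of_isotropic hY (h.riem_eq_scalarCurv hK (by omega))
      (by simpa using hn) i
  set y : Coord n := EuclideanSpace.single ⟨0, by omega⟩ 1 with hy
  have hy0 : y ≠ 0 := by simp [hy]
  have hd : DifferentiableAt ℝ s x :=
    ((hrep.hasFDerivAt ⟨(x, y), hx, hy0⟩).comp (f := fun x : Coord n => (x, y)) x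
      (hasFDerivAt_prodMk_left x y)).differentiableAt
  have hz : fderiv ℝ s x = 0 := by
    ext u
    rw [← sum_coord_mul_single]
    refine Finset.sum_eq_zero fun i _ => ?_
    have h1 := hrep.dx i ⟨(x, y), hx, hy0⟩
    rw [hX, map_zero] at h1
    have h2 : fderiv ℝ s x (EuclideanSpace.single i 1) = 0 := h1
    rw [h2, mul_zero]
  rw [← hz]
  exact hd.hasFDerivAt

end IsLocalFinsler

end Schur

/-! ### Homogeneous polynomials and rational roots of polynomials -/

section Polynomial

open MvPolynomial

variable {ι : Type*}

theorem totalDegree_pderiv_le (i : ι) (p : MvPolynomial ι ℝ) :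
    (pderiv i p).totalDegree ≤ p.totalDegree := by
  classical
  conv_lhs => rw [p.as_sum, map_sum]
  refine totalDegree_finsetSum_le fun s hs => ?_
  rw [pderiv_monomial]
  refine (totalDegree_monomial_le _ _).trans (le_trans ?_ (le_totalDegree hs))
  exact Finsupp.sum_le_sum_index tsub_le_self (fun _ _ => monotone_id) (fun _ _ => rfl)

theorem eval_smul_of_isHomogeneous {p : MvPolynomial ι ℝ} {k : ℕ} (hp : p.IsHomogeneous k)
    (c : ℝ) (y : ι → ℝ) : eval (fun i => c * y i) p = c ^ k * eval y p := by
  rw [eval_eq, eval_eq, Finset.mul_sum]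
  refine Finset.sum_congr rfl fun d hd => ?_
  have hk : ∑ i ∈ d.support, d i = k := by
    have := hp (mem_support_iff.1 hd)
    rw [Finsupp.weight_apply, Finsupp.sum] at this
    simpa using this
  simp only [mul_pow, Finset.prod_mul_distrib, Finset.prod_pow_eq_pow_sum, hk]
  ring

/-- For fixed `y` both sides of the scaling law are polynomials in `c` that agree for all `c > 0`;
compare coefficients of `c ^ k`. -/
theorem eval_homogeneousComponent_of_scaling {p : MvPolynomial ι ℝ} {k : ℕ} {y : ι → ℝ}
    (h : ∀ c : ℝ, 0 < c → eval (fun i => c * y i) p = c ^ k * eval y p) :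
    eval y (homogeneousComponent k p) = eval y p := by
  set N := p.totalDegree + 1 with hN
  set P : Polynomial ℝ := ∑ j ∈ Finset.range N,
    Polynomial.C (eval y (homogeneousComponent j p)) * Polynomial.X ^ j
      - Polynomial.C (eval y p) * Polynomial.X ^ k with hP
  have hroot : ∀ c : ℝ, 0 < c → P.IsRoot c := by
    intro c hc
    have h1 := h c hc
    conv_lhs at h1 => rw [← sum_homogeneousComponent p, map_sum]
    simp only [eval_smul_of_isHomogeneous (homogeneousComponent_isHomogeneous _ p)] at h1
    simp only [Polynomial.IsRoot, hP, Polynomial.eval_sub, Polynomial.eval_finsetSum,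
      Polynomial.eval_mul, Polynomial.eval_C, Polynomial.eval_pow, Polynomial.eval_X]
    rw [Finset.sum_congr rfl fun j _ => mul_comm _ _, h1]
    ring
  have hP0 : P = 0 := Polynomial.eq_zero_of_infinite_isRoot P
    ((Set.Ioi_infinite (0 : ℝ)).mono fun c hc => hroot c hc)
  have hcoeff := congrArg (fun Q => Polynomial.coeff Q k) hP0
  simp only [hP, Polynomial.coeff_sub, Polynomial.finsetSum_coeff, Polynomial.coeff_C_mul,
    Polynomial.coeff_X_pow, Polynomial.coeff_zero, mul_ite, mul_one, mul_zero,
    Finset.sum_ite_eq, if_true, Finset.mem_range] at hcoeff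
  split_ifs at hcoeff with hk
  · linarith
  · rw [homogeneousComponent_eq_zero k p (by omega), map_zero]
    linarith

/-- Euler's identity applied twice; the second partial derivatives are constants. -/
theorem exists_eval_eq_quadratic [Fintype ι] {p : MvPolynomial ι ℝ} (hp : p.IsHomogeneous 2) :
    ∃ c : ι → ι → ℝ, ∀ y : ι → ℝ, eval y p = ∑ i, ∑ j, c i j * y i * y j := by
  have hc (i j : ι) : ∃ c : ℝ, pderiv j (pderiv i p) = C c :=
    ⟨_, totalDegree_eq_zero_iff_eq_C.1
      ((totalDegree_zero_iff_isHomogeneous _).2 (hp.pderiv (i := i)).pderiv)⟩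
  choose c hc using hc
  refine ⟨fun i j => c i j / 2, fun y => ?_⟩
  have h1 := congrArg (eval y) hp.sum_X_mul_pderiv
  have h2 (i : ι) := congrArg (eval y) (hp.pderiv (i := i)).sum_X_mul_pderiv
  simp only [hc, map_sum, map_mul, eval_X, eval_C, nsmul_eq_mul] at h1 h2
  norm_num at h1 h2
  have h3 : eval y p = (1 / 2) * ∑ i, y i * eval y (pderiv i p) := by linarith
  rw [h3, Finset.mul_sum]
  refine Finset.sum_congr rfl fun i _ => ?_
  rw [← h2, Finset.mul_sum, Finset.mul_sum]
  exact Finset.sum_congr rfl fun j _ => by ring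

/-- A positively `2`-homogeneous function on `ℝⁿ ∖ {0}` which is a quotient of polynomials and one
of whose powers is a polynomial is a quadratic form. -/
theorem exists_quadratic_of_rational {n l : ℕ} (hn : 0 < n) (hl : l ≠ 0) {f : Coord n → ℝ}
    (hf : ∀ y, ∀ c : ℝ, 0 ≤ c → f (c • y) = c ^ 2 * f y) {a p q : MvPolynomial (Fin n) ℝ}
    (ha : ∀ y : Coord n, f y ^ l = eval y.ofLp a)
    (hq : ∀ y : Coord n, y ≠ 0 → eval y.ofLp q ≠ 0)
    (hpq : ∀ y : Coord n, y ≠ 0 → f y * eval y.ofLp q = eval y.ofLp p) :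
    ∃ c : Fin n → Fin n → ℝ, ∀ y, f y = ∑ i, ∑ j, c i j * y i * y j := by
  have hpow : p ^ l = a * q ^ l := by
    -- The hypotheses on `p` and `q` say nothing at the origin; multiplying by a variable makes the
    -- identity trivial there.
    have h0 : (X (⟨0, hn⟩ : Fin n) : MvPolynomial (Fin n) ℝ) ≠ 0 := X_ne_zero _
    apply mul_left_cancel₀ h0
    refine MvPolynomial.funext fun z => ?_
    by_cases hz : WithLp.toLp 2 z = (0 : Coord n)
    · have : z = 0 := by simpa using hz
      simp [this]
    · have h1 := hpq (WithLp.toLp 2 z) hz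
      have h2 := ha (WithLp.toLp 2 z)
      simp only [map_mul, map_pow] at h1 h2 ⊢
      rw [← h1, ← h2]
      ring
  -- Polynomial rings over a field are integrally closed, so `q ^ l ∣ p ^ l` gives `q ∣ p`, and `f`
  -- is the polynomial `t` off the origin.
  obtain ⟨t, rfl⟩ : q ∣ p := (IsIntegrallyClosed.pow_dvd_pow_iff hl).1 ⟨a, by rw [hpow]; ring⟩
  have ht : ∀ y : Coord n, y ≠ 0 → f y = eval y.ofLp t := by
    intro y hy
    have h1 := hpq y hy
    rw [map_mul, mul_comm] at h1
    exact mul_left_cancel₀ (hq y hy) h1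
  have hhom := homogeneousComponent_isHomogeneous 2 t
  obtain ⟨c, hc⟩ := exists_eval_eq_quadratic hhom
  refine ⟨c, fun y => ?_⟩
  rw [← hc y.ofLp]
  by_cases hy : y = 0
  · have h1 := hf 0 0 le_rfl
    have h2 := hc 0
    subst hy
    rw [smul_zero] at h1
    simp only [Pi.zero_apply, mul_zero, Finset.sum_const_zero] at h2
    change f 0 = eval (0 : Fin n → ℝ) _
    rw [h1, h2]
    ring
  · rw [eval_homogeneousComponent_of_scaling, ht y hy]
    intro c hc'
    have h1 := ht (c • y) (smul_ne_zero hc'.ne' hy)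
    rw [hf y c hc'.le, ht y hy] at h1
    exact h1.symm

end Polynomial

/-! ### Smooth functions that are polynomial on the fibres -/

section FibrewisePolynomial

open MvPolynomial Filter

variable {n : ℕ}

theorem hasFDerivAt_eval (p : MvPolynomial (Fin n) ℝ) (y : Coord n) :
    HasFDerivAt (fun y : Coord n => eval y.ofLp p)
      (∑ i, eval y.ofLp (pderiv i p) • (EuclideanSpace.proj i : Coord n →L[ℝ] ℝ)) y := by
  induction p using MvPolynomial.induction_on with
  | C c => simpa using hasFDerivAt_const c y
  | add p q hp hq =>
    simp only [map_add, add_smul, Finset.sum_add_distrib]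
    exact hp.add hq
  | mul_X p i hp =>
    have hi : HasFDerivAt (fun y : Coord n => y.ofLp i)
        (EuclideanSpace.proj i : Coord n →L[ℝ] ℝ) y :=
      (EuclideanSpace.proj i : Coord n →L[ℝ] ℝ).hasFDerivAt
    have h1 := hp.mul hi
    simp only [map_mul, eval_X]
    refine h1.congr_fderiv ?_
    simp only [Derivation.leibniz, pderiv_X, smul_eq_mul, map_add, map_mul, eval_X, add_smul,
      Finset.sum_add_distrib, Finset.smul_sum, mul_smul]
    congr 1
    rw [Finset.sum_eq_single i]
    · simp
    · intro j _ hj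
      simp [Pi.single_eq_of_ne hj.symm]
    · simp

/-- Polynomials as functions on `ℝⁿ ∖ {0}`. -/
def polyEval (n : ℕ) : MvPolynomial (Fin n) ℝ →ₗ[ℝ] ({y : Coord n // y ≠ 0} → ℝ) where
  toFun p y := eval y.1.ofLp p
  map_add' p q := by ext; simp
  map_smul' c p := by ext; simp

theorem polyEval_apply (p : MvPolynomial (Fin n) ℝ) (y : {y : Coord n // y ≠ 0}) :
    polyEval n p y = eval y.1.ofLp p := rfl

/-- The functions on `ℝⁿ ∖ {0}` given by polynomials of degree at most `N`. -/
def polyFun (n N : ℕ) : Submodule ℝ ({y : Coord n // y ≠ 0} → ℝ) :=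
  (restrictTotalDegree (Fin n) ℝ N).map (polyEval n)

theorem mem_polyFun {N : ℕ} {f : {y : Coord n // y ≠ 0} → ℝ} :
    f ∈ polyFun n N ↔ ∃ p : MvPolynomial (Fin n) ℝ, p.totalDegree ≤ N ∧
      ∀ y : {y : Coord n // y ≠ 0}, f y = eval y.1.ofLp p := by
  constructor
  · rintro ⟨p, hp, rfl⟩
    exact ⟨p, by rwa [SetLike.mem_coe, mem_restrictTotalDegree] at hp, polyEval_apply p⟩
  · rintro ⟨p, hp, h⟩
    have hf : polyEval n p = f := by
      funext y
      rw [polyEval_apply, h y]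
    have hmem : p ∈ restrictTotalDegree (Fin n) ℝ N := by
      rwa [mem_restrictTotalDegree]
    rw [← hf]
    exact Submodule.mem_map_of_mem hmem

theorem polyFun_mono {N N' : ℕ} (h : N ≤ N') : polyFun n N ≤ polyFun n N' := by
  intro f hf
  obtain ⟨p, hp, h'⟩ := mem_polyFun.1 hf
  exact mem_polyFun.2 ⟨p, hp.trans h, h'⟩

/-- Finite-dimensional subspaces are closed for pointwise convergence. The degree bound, uniform in
`x`, is what permits limits over varying base points. -/
theorem isClosed_polyFun (N : ℕ) : IsClosed (polyFun n N : Set ({y : Coord n // y ≠ 0} → ℝ)) := by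
  have : FiniteDimensional ℝ (polyFun n N) := by unfold polyFun; infer_instance
  exact Submodule.closed_of_finiteDimensional _

variable {U : Opens (Coord n)}

/-- The restriction of a function to the fibre over `x`. -/
def fibre (f : smoothAlgebra (slit U)) (x : Coord n) : {y : Coord n // y ≠ 0} → ℝ :=
  fun y => extend f (x, y)

theorem fibre_apply (f : smoothAlgebra (slit U)) {x : Coord n} (hx : x ∈ U)
    (y : {y : Coord n // y ≠ 0}) : fibre f x y = evalAt (⟨(x, y.1), hx, y.2⟩ : slit U) f :=
  extend_apply f ⟨(x, y.1), hx, y.2⟩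

/-- The smooth functions which are polynomials of bounded degree on every fibre. -/
def fibrePoly (U : Opens (Coord n)) : Subalgebra ℝ (smoothAlgebra (slit U)) where
  carrier := {f | ∃ N, ∀ x ∈ U, fibre f x ∈ polyFun n N}
  mul_mem' := by
    rintro f g ⟨N, hf⟩ ⟨N', hg⟩
    refine ⟨N + N', fun x hx => ?_⟩
    obtain ⟨p, hp, hfp⟩ := mem_polyFun.1 (hf x hx)
    obtain ⟨q, hq, hgq⟩ := mem_polyFun.1 (hg x hx)
    refine mem_polyFun.2 ⟨p * q, (totalDegree_mul p q).trans (add_le_add hp hq), fun y => ?_⟩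
    rw [fibre_apply _ hx, map_mul, map_mul, ← hfp, ← hgq, fibre_apply _ hx, fibre_apply _ hx]
  add_mem' := by
    rintro f g ⟨N, hf⟩ ⟨N', hg⟩
    refine ⟨max N N', fun x hx => ?_⟩
    have h : fibre (f + g) x = fibre f x + fibre g x := by
      funext y
      rw [Pi.add_apply, fibre_apply _ hx, fibre_apply _ hx, fibre_apply _ hx, map_add]
    rw [h]
    exact add_mem (polyFun_mono (le_max_left _ _) (hf x hx))
      (polyFun_mono (le_max_right _ _) (hg x hx))
  algebraMap_mem' r := ⟨0, fun x hx => mem_polyFun.2 ⟨C r, by simp, fun y => by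
    rw [fibre_apply _ hx, eval_C]; rfl⟩⟩

theorem fibreCoord_mem_fibrePoly (i : Fin n) : (slitCalculus U).y i ∈ fibrePoly U :=
  ⟨1, fun x hx => mem_polyFun.2 ⟨X i, by simp, fun y => by
    rw [fibre_apply _ hx, eval_X]; rfl⟩⟩

theorem Y_mem_fibrePoly (i : Fin n) {f : smoothAlgebra (slit U)} (hf : f ∈ fibrePoly U) :
    (slitCalculus U).Y i f ∈ fibrePoly U := by
  obtain ⟨N, hf⟩ := hf
  refine ⟨N, fun x hx => ?_⟩
  obtain ⟨p, hp, hfp⟩ := mem_polyFun.1 (hf x hx)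
  refine mem_polyFun.2 ⟨pderiv i p, (totalDegree_pderiv_le i p).trans hp, fun y => ?_⟩
  have hrep : Represents (fun x y => extend f (x, y)) f := fun p => extend_apply f p
  rw [fibre_apply _ hx, ← hrep.dy i ⟨(x, y.1), hx, y.2⟩]
  have hev : (fun z : Coord n => extend f (x, z)) =ᶠ[nhds y.1] fun z => eval z.ofLp p := by
    filter_upwards [isOpen_compl_singleton.mem_nhds y.2] with z hz
    exact hfp ⟨z, hz⟩
  change fderiv ℝ (fun z : Coord n => extend f (x, z)) y.1 _ = _
  rw [hev.fderiv_eq, (hasFDerivAt_eval p y.1).fderiv]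
  simp

/-- The `x`-derivative is a pointwise limit of difference quotients, each polynomial of degree at
most `N`, so smoothness of the coefficients in `x` is never needed. -/
theorem X_mem_fibrePoly (i : Fin n) {f : smoothAlgebra (slit U)} (hf : f ∈ fibrePoly U) :
    (slitCalculus U).X i f ∈ fibrePoly U := by
  obtain ⟨N, hf⟩ := hf
  refine ⟨N, fun x hx => ?_⟩
  set e : Coord n := EuclideanSpace.single i 1
  have hrep : Represents (fun x y => extend f (x, y)) f := fun p => extend_apply f p
  have hlim : Tendsto (fun t : ℝ => t⁻¹ • (fibre f (x + t • e) - fibre f x)) (nhdsWithin 0 {0}ᶜ)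
      (nhds (fibre ((slitCalculus U).X i f) x)) := by
    rw [tendsto_pi_nhds]
    intro y
    rw [fibre_apply _ hx, ← hrep.dx i ⟨(x, y.1), hx, y.2⟩]
    have hd : DifferentiableAt ℝ (fun x : Coord n => extend f (x, y.1)) x :=
      ((hrep.hasFDerivAt ⟨(x, y.1), hx, y.2⟩).comp (f := fun x : Coord n => (x, y.1)) x
        (hasFDerivAt_prodMk_left x y.1)).differentiableAt
    exact (hd.hasFDerivAt.hasLineDerivAt e).tendsto_slope_zero
  refine (isClosed_polyFun N).mem_of_tendsto hlim ?_
  have hc : ContinuousAt (fun t : ℝ => x + t • e) 0 := by fun_prop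
  have hU : ∀ᶠ t : ℝ in nhds 0, x + t • e ∈ U :=
    hc.eventually_mem (U.2.mem_nhds (by simpa using hx))
  filter_upwards [nhdsWithin_le_nhds hU] with t ht
  exact Submodule.smul_mem _ _ (sub_mem (hf _ ht) (hf x hx))

end FibrewisePolynomial

namespace IsLocalFinsler

variable {n : ℕ} {U : Opens (Coord n)} {F : Coord n → Coord n → ℝ} {s : Coord n → ℝ}
  (h : IsLocalFinsler U F)
  (hK : ∀ x ∈ U, ∀ y, y ≠ 0 → ∀ i k, riemann F i k x y = s x * F x y ^ 2 * angular F i k x y)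
include h hK

/-- If `F ^ (2 l)` is polynomial on every tangent space and the flag curvature `s x` is isotropic
and does not vanish at `x`, then `F²` is a quadratic form on the tangent space at `x`. -/
theorem exists_quadratic_of_scalarCurv_ne_zero (hn : 2 ≤ n) {l N : ℕ} (hl : l ≠ 0)
    (hA : ∀ x ∈ U, ∃ p : MvPolynomial (Fin n) ℝ, p.totalDegree ≤ N ∧
      ∀ y : Coord n, (F x y ^ 2) ^ l = MvPolynomial.eval y.ofLp p)
    {x : Coord n} (hx : x ∈ U) (hs : s x ≠ 0) :
    ∃ c : Fin n → Fin n → ℝ, ∀ y, F x y ^ 2 = ∑ i, ∑ j, c i j * y i * y j := by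
  have hsq : IsUnit h.sq := isUnit_of_ne_zero fun p =>
    pow_ne_zero 2 (h.pos p.1.1 p.2.1 p.1.2 p.2.2).ne'
  have hmem : h.sq ^ l ∈ fibrePoly U := by
    refine ⟨N, fun x hx => ?_⟩
    obtain ⟨p, hp, hFp⟩ := hA x hx
    refine mem_polyFun.2 ⟨p, hp, fun y => ?_⟩
    rw [fibre_apply _ hx, map_pow, ← h.represents_sq]
    exact hFp y
  have hr (i : Fin n) := h.isGeodesicSpray.riem_mem_fractions (P := fibrePoly U)
    (fun i _ => X_mem_fibrePoly i) (fun i _ => Y_mem_fibrePoly i)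
    fibreCoord_mem_fibrePoly hl hsq hmem i i
  obtain ⟨p, ⟨Np, hp⟩, q, ⟨Nq, hq⟩, hqu, hpq⟩ :=
    sum_mem (S := fractions (fibrePoly U)) fun i (_ : i ∈ Finset.univ) => hr i
  obtain ⟨p', -, hp'⟩ := mem_polyFun.1 (hp x hx)
  obtain ⟨q', -, hq'⟩ := mem_polyFun.1 (hq x hx)
  obtain ⟨a, -, ha⟩ := hA x hx
  have hn' : (n : ℝ) - 1 ≠ 0 := by
    have : (2 : ℝ) ≤ n := by exact_mod_cast hn
    linarith
  refine exists_quadratic_of_rational (by omega) hl (f := fun y => F x y ^ 2)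
    (fun y c hc => by rw [h.homog x hx y c hc, mul_pow]) ha
    -- The trace `p' / q'` of the curvature equals `s x (n - 1) F²`, hence the constant.
    (p := MvPolynomial.C (s x * (n - 1))⁻¹ * p') (q := q') ?_ ?_
  · intro y hy
    rw [← hq' ⟨y, hy⟩, fibre_apply _ hx]
    exact ne_zero_of_isUnit hqu _
  · intro y hy
    have h1 := congrArg (evalAt (⟨(x, y), hx, hy⟩ : slit U)) hpq
    rw [map_mul, map_sum] at h1
    simp only [← h.represents_riem _ _ ⟨(x, y), hx, hy⟩] at h1
    rw [h.sum_riemann (K := fun x _ => s x) hK hx hy] at h1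
    rw [map_mul, MvPolynomial.eval_C, ← hq' ⟨y, hy⟩, ← hp' ⟨y, hy⟩, fibre_apply _ hx,
      fibre_apply _ hx, ← h1]
    field_simp

end IsLocalFinsler

/-! ### Passage between the manifold and charts -/

section Charts

variable {n : ℕ} {M : Type*} [TopologicalSpace M] [ChartedSpace (Coord n) M]

/-- The target of a chart as an open subset of `ℝⁿ`. -/
def chartTarget (e : OpenPartialHomeomorph M (Coord n)) : Opens (Coord n) :=
  ⟨e.target, e.open_target⟩

theorem exists_chart_symm_eq (x : M) :
    ∃ e ∈ atlas (Coord n) M, ∃ z ∈ e.target, e.symm z = x :=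
  ⟨chartAt (Coord n) x, chart_mem_atlas _ x, chartAt (Coord n) x x, mem_chart_target _ x,
    (chartAt (Coord n) x).left_inv (mem_chart_source _ x)⟩

theorem pow_neg_of_isMthRoot {m : ℕ} {F : TangentBundle (𝓡 n) M → ℝ} (h : IsMthRoot m F) (x : M)
    (y : TangentSpace (𝓡 n) x) : F ⟨x, -y⟩ ^ m = (-1) ^ m * F ⟨x, y⟩ ^ m := by
  obtain ⟨-, a, -, ha⟩ := h
  have h1 := (a x).map_smul_univ (fun _ => (-1 : ℝ)) (fun _ => y)
  simp only [neg_smul, one_smul, Finset.prod_const, Finset.card_univ, Fintype.card_fin,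
    smul_eq_mul] at h1
  rw [ha, ha, h1]

variable [IsManifold (𝓡 n) ∞ M] {F : TangentBundle (𝓡 n) M → ℝ}

/-- For odd `m` the function `F ^ m` would change sign under `y ↦ -y`, against positivity. -/
theorem even_of_isMthRoot {m : ℕ} (hF : IsFinslerMetric F) (h : IsMthRoot m F) {x : M}
    {y : TangentSpace (𝓡 n) x} (hy : y ≠ 0) : Even m := by
  by_contra hm
  have h1 := pow_neg_of_isMthRoot h x y
  rw [(Nat.not_even_iff_odd.1 hm).neg_one_pow] at h1
  have h2 := pow_pos (hF.pos x y hy) m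
  have h3 := pow_pos (hF.pos x (-y) (neg_ne_zero.2 hy)) m
  linarith

theorem apply_neg_of_isMthRoot {m : ℕ} (hF : IsFinslerMetric F) (h : IsMthRoot m F) (x : M)
    (y : TangentSpace (𝓡 n) x) : F ⟨x, -y⟩ = F ⟨x, y⟩ := by
  by_cases hy : y = 0
  · rw [hy, neg_zero]
  have h1 := pow_neg_of_isMthRoot h x y
  rw [(even_of_isMthRoot hF h hy).neg_one_pow, one_mul] at h1
  exact (pow_left_inj₀ (hF.pos x (-y) (neg_ne_zero.2 hy)).le (hF.pos x y hy).le
    (Nat.one_le_iff_ne_zero.1 h.1)).1 h1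

variable {e : OpenPartialHomeomorph M (Coord n)} (he : e ∈ atlas (Coord n) M)

/-- The coordinate frame of a chart as a linear equivalence. -/
def frame {x : Coord n} (hx : x ∈ e.target) : Coord n ≃L[ℝ] TangentSpace (𝓡 n) (e.symm x) :=
  have : IsManifold (𝓡 n) 1 M := IsManifold.of_le (n := ∞) (by simp)
  (mdifferentiable_of_mem_atlas (I := 𝓡 n) he).symm.mfderiv hx

theorem inChart_eq (f : TangentBundle (𝓡 n) M → ℝ) {x : Coord n} (hx : x ∈ e.target) (y : Coord n) :
    inChart e f x y = f ⟨e.symm x, frame he hx y⟩ := rfl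

include he in
theorem contDiffOn_inChart (hF : IsFinslerMetric F) :
    ContDiffOn ℝ ∞ (fun p : Coord n × Coord n => inChart e F p.1 p.2) (slit (chartTarget e)) := by
  have hsymm : ContMDiffOn (𝓡 n) (𝓡 n) ∞ e.symm e.target :=
    contMDiffOn_symm_of_mem_maximalAtlas (IsManifold.subset_maximalAtlas he)
  have h1 := hsymm.contMDiffOn_tangentMapWithin (m := ∞) (by simp) e.open_target.uniqueMDiffOn
  have h2 : ContMDiff 𝓘(ℝ, Coord n × Coord n) (𝓡 n).tangent ∞
      (fun p : Coord n × Coord n => (⟨p.1, p.2⟩ : TangentBundle (𝓡 n) (Coord n))) := by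
    rw [modelWithCornersSelf_prod]
    exact contMDiff_tangentBundleModelSpaceHomeomorph_symm (I := 𝓡 n)
  have h3 := h1.comp (s := (slit (chartTarget e) : Set (Coord n × Coord n))) h2.contMDiffOn
    (fun p hp => hp.1)
  have h4 := hF.smooth.comp h3 (by
    intro p hp
    have hx : p.1 ∈ e.target := hp.1
    change mfderivWithin (𝓡 n) (𝓡 n) e.symm e.target p.1 p.2 ≠ 0
    rw [mfderivWithin_of_isOpen e.open_target hx]
    exact fun h => hp.2 ((frame he hx).map_eq_zero_iff.1 h))
  rw [← contMDiffOn_iff_contDiffOn]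
  refine h4.congr fun p hp => ?_
  have hx : p.1 ∈ e.target := hp.1
  change F ⟨e.symm p.1, mfderiv (𝓡 n) (𝓡 n) e.symm p.1 p.2⟩
    = F ⟨e.symm p.1, mfderivWithin (𝓡 n) (𝓡 n) e.symm e.target p.1 p.2⟩
  rw [mfderivWithin_of_isOpen e.open_target hx]

include he in
theorem isLocalFinsler_inChart (hF : IsFinslerMetric F) :
    IsLocalFinsler (chartTarget e) (inChart e F) where
  smooth := contDiffOn_inChart he hF
  pos x hx y hy := by
    rw [inChart_eq he F hx]
    exact hF.pos _ _ ((frame he hx).map_ne_zero_iff.2 hy)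
  homog x hx y c hc := by
    rw [inChart_eq he F hx, inChart_eq he F hx, map_smul, hF.homogeneous _ _ c hc]
  posDef x hx y u hy hu := by
    have h1 := hF.posDef (e.symm x) (frame he hx y) (frame he hx u)
      ((frame he hx).map_ne_zero_iff.2 hy) ((frame he hx).map_ne_zero_iff.2 hu)
    simp only [inChart_eq he F hx, map_add, map_smul]
    rw [fundamentalForm] at h1
    linarith

include he in
theorem hasParity_inChart {m : ℕ} (hF : IsFinslerMetric F) (h : IsMthRoot m F) :
    HasParity (chartTarget e) 1 (inChart e F) := by
  intro x hx y
  rw [inChart_eq he F hx, inChart_eq he F hx, map_neg, apply_neg_of_isMthRoot hF h, one_mul]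

include he in
-- Expand the multilinear form in the coordinate frame. The bound `m` does not depend on `x`, as
-- `fibrePoly` requires.
theorem exists_polynomial_of_isMthRoot {m : ℕ} (h : IsMthRoot m F) {x : Coord n}
    (hx : x ∈ e.target) : ∃ p : MvPolynomial (Fin n) ℝ, p.totalDegree ≤ m ∧
      ∀ y : Coord n, inChart e F x y ^ m = MvPolynomial.eval y.ofLp p := by
  obtain ⟨-, a, -, ha⟩ := h
  refine ⟨∑ r : Fin m → Fin n, MvPolynomial.C (a (e.symm x) fun i =>
    frame he hx (EuclideanSpace.single (r i) 1)) * ∏ i, MvPolynomial.X (r i), ?_, fun y => ?_⟩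
  · refine MvPolynomial.totalDegree_finsetSum_le fun r _ => ?_
    refine (MvPolynomial.totalDegree_mul _ _).trans ?_
    rw [MvPolynomial.totalDegree_C, zero_add]
    refine (MvPolynomial.totalDegree_finsetProd _ _).trans ?_
    simp
  · rw [inChart_eq he F hx, ha]
    have hy : frame he hx y = ∑ j, y j • frame he hx (EuclideanSpace.single j 1) := by
      conv_lhs => rw [← (EuclideanSpace.basisFun (Fin n) ℝ).sum_repr y, map_sum]
      simp
    rw [hy, MultilinearMap.map_sum]
    simp only [MultilinearMap.map_smul_univ, map_sum, map_mul, MvPolynomial.eval_C, map_prod,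
      MvPolynomial.eval_X, smul_eq_mul]
    exact Finset.sum_congr rfl fun r _ => mul_comm _ _

include he in
theorem exists_quadraticForm_of_coordinates {x : Coord n} (hx : x ∈ e.target)
    {c : Fin n → Fin n → ℝ} (hc : ∀ y, inChart e F x y ^ 2 = ∑ i, ∑ j, c i j * y i * y j) :
    ∃ q : QuadraticForm ℝ (TangentSpace (𝓡 n) (e.symm x)),
      ∀ y : TangentSpace (𝓡 n) (e.symm x), F ⟨e.symm x, y⟩ ^ 2 = q y := by
  set ℓ : Fin n → TangentSpace (𝓡 n) (e.symm x) →ₗ[ℝ] ℝ := fun i =>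
    (EuclideanSpace.proj i : Coord n →L[ℝ] ℝ).toLinearMap ∘ₗ
      ((frame he hx).symm : TangentSpace (𝓡 n) (e.symm x) →ₗ[ℝ] Coord n)
  refine ⟨∑ i, ∑ j, c i j • QuadraticMap.linMulLin (ℓ i) (ℓ j), fun y => ?_⟩
  have h1 := hc ((frame he hx).symm y)
  rw [inChart_eq he F hx, ContinuousLinearEquiv.apply_symm_apply] at h1
  rw [h1]
  simp only [_root_.sum_apply, _root_.smul_apply, QuadraticMap.linMulLin_apply,
    smul_eq_mul, mul_assoc]
  rfl

end Charts

/-! ### Scalar flag curvature on the manifold -/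

section ScalarCurvature

variable {n m : ℕ} {M : Type*} [TopologicalSpace M]
    [ChartedSpace (Coord n) M] [IsManifold (𝓡 n) ∞ M]
    {F : TangentBundle (𝓡 n) M → ℝ} (hF : IsFinslerMetric F)
    (hroot : IsMthRoot m F)
    {K : TangentBundle (𝓡 n) M → ℝ} (hK : HasScalarFlagCurvature F K)
include hF hK

include hroot in
theorem flagCurvature_neg (hn : 2 ≤ n) (x : M) (y : TangentSpace (𝓡 n) x) (hy : y ≠ 0) :
    K ⟨x, -y⟩ = K ⟨x, y⟩ := by
  obtain ⟨e, he, z, hz, rfl⟩ := exists_chart_symm_eq (n := n) x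
  have h1 := (isLocalFinsler_inChart he hF).flagCurvature_even (K := inChart e K)
    (fun x hx y hy i k => hK e he x hx y hy i k) hn (hasParity_inChart he hF hroot) (x := z) hz
    (y := (frame he hz).symm y) ((frame he hz).symm.map_ne_zero_iff.2 hy)
  rwa [inChart_eq he K hz, inChart_eq he K hz, map_neg,
    ContinuousLinearEquiv.apply_symm_apply] at h1

variable {σ : M → ℝ} (hσ : ∀ (x : M) (y : TangentSpace (𝓡 n) x), y ≠ 0 → K ⟨x, y⟩ = σ x)
include hσ

omit hF in
theorem riemann_inChart {e : OpenPartialHomeomorph M (Coord n)} (he : e ∈ atlas (Coord n) M) :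
    ∀ x ∈ chartTarget e, ∀ y, y ≠ 0 → ∀ i k, riemann (inChart e F) i k x y
      = (σ ∘ e.symm) x * inChart e F x y ^ 2 * angular (inChart e F) i k x y := by
  intro x hx y hy i k
  have hx' : x ∈ e.target := hx
  have hKσ : inChart e K x y = σ (e.symm x) := by
    rw [inChart_eq he K hx']
    exact hσ _ _ ((frame he hx').map_ne_zero_iff.2 hy)
  rw [hK e he x hx y hy i k, hKσ, Function.comp_apply]

/-- Schur's lemma: a flag curvature depending only on the base point is locally constant. -/
theorem isLocallyConstant_flagCurvature (hn : 3 ≤ n) : IsLocallyConstant σ := by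
  rw [IsLocallyConstant.iff_eventually_eq]
  intro x
  obtain ⟨e, he, z, hz, rfl⟩ := exists_chart_symm_eq (n := n) x
  have hd : ∀ z ∈ e.target, HasFDerivAt (σ ∘ e.symm) (0 : Coord n →L[ℝ] ℝ) z := fun z hz =>
    (isLocalFinsler_inChart he hF).hasFDerivAt_scalarCurv (riemann_inChart hK hσ he) hn hz
  have hopen := e.open_target.isOpen_inter_preimage_of_fderiv_eq_zero
    (fun z hz => (hd z hz).differentiableAt.differentiableWithinAt)
    (fun z hz => (hd z hz).fderiv) {σ (e.symm z)}
  have hcont : ContinuousAt e (e.symm z) := e.continuousAt (e.map_target hz)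
  have hmem : ∀ᶠ w in nhds (e.symm z), e w ∈ e.target ∩ σ ∘ e.symm ⁻¹' {σ (e.symm z)} := by
    refine hcont.eventually_mem (hopen.mem_nhds ?_)
    rw [e.right_inv hz]
    exact ⟨hz, rfl⟩
  filter_upwards [hmem, e.open_source.mem_nhds (e.map_target hz)] with w hw hws
  have := hw.2
  simpa only [Set.mem_preimage, Function.comp_apply, e.left_inv hws, Set.mem_singleton_iff] using this

include hroot in
theorem exists_quadraticForm_of_flagCurvature_ne_zero (hn : 2 ≤ n) {x : M} (hx : σ x ≠ 0) :
    ∃ q : QuadraticForm ℝ (TangentSpace (𝓡 n) x),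
      ∀ y : TangentSpace (𝓡 n) x, F ⟨x, y⟩ ^ 2 = q y := by
  obtain ⟨e, he, z, hz, rfl⟩ := exists_chart_symm_eq (n := n) x
  have hy0 : (EuclideanSpace.single ⟨0, by omega⟩ 1 : Coord n) ≠ 0 := by simp
  -- Write `m = 2 l`, so that `(F²) ^ l` is polynomial; evenness needs a nonzero tangent vector to
  -- test on.
  obtain ⟨l, hl⟩ := (even_of_isMthRoot hF hroot ((frame he hz).map_ne_zero_iff.2 hy0)).two_dvd
  have hm := hroot.1
  obtain ⟨c, hc⟩ := (isLocalFinsler_inChart he hF).exists_quadratic_of_scalarCurv_ne_zero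
    (riemann_inChart hK hσ he) hn (l := l) (N := m) (by omega)
    (fun x hx => by
      simp only [← pow_mul, ← hl]
      exact exists_polynomial_of_isMthRoot he hroot hx) hz hx
  exact exists_quadraticForm_of_coordinates he hz hc

end ScalarCurvature

end Finsler
end

theorem corollary1 {n m : ℕ} (hn : 3 ≤ n) {M : Type*} [TopologicalSpace M]
    [ChartedSpace (Finsler.Coord n) M] [IsManifold (𝓡 n) ∞ M]
    [ConnectedSpace M]
    (F : TangentBundle (𝓡 n) M → ℝ) (hF : Finsler.IsFinslerMetric F)
    (hroot : Finsler.IsMthRoot m F) (hnonRiem : ¬ Finsler.IsRiemannian F)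
    (K : TangentBundle (𝓡 n) M → ℝ) (hK : Finsler.HasScalarFlagCurvature F K)
    (θ : (x : M) → TangentSpace (𝓡 n) x →ₗ[ℝ] ℝ) (σ : M → ℝ)
    (hform : ∀ (x : M) (y : TangentSpace (𝓡 n) x), y ≠ 0 →
      K ⟨x, y⟩ = 3 * θ x y / F ⟨x, y⟩ + σ x) :
    ∀ (x : M) (y : TangentSpace (𝓡 n) x), y ≠ 0 → K ⟨x, y⟩ = 0 := by
  have hσ : ∀ (x : M) (y : TangentSpace (𝓡 n) x), y ≠ 0 → K ⟨x, y⟩ = σ x := by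
    intro x y hy
    have h1 := Finsler.flagCurvature_neg hF hroot hK (by omega) x y hy
    rw [hform x y hy, hform x (-y) (neg_ne_zero.2 hy), map_neg,
      Finsler.apply_neg_of_isMthRoot hF hroot] at h1
    -- The curvature and `F` are even in `y` while `θ` is odd, so this term equals its own negative.
    have h2 : 3 * θ x y / F ⟨x, y⟩ = 0 := by
      rw [mul_neg, neg_div] at h1
      linarith
    rw [hform x y hy, h2, zero_add]
  -- A single tangent space on which `F²` is not quadratic is enough, since `σ` is constant.
  obtain ⟨x₀, hx₀⟩ := not_forall.1 hnonRiem
  have h0 : σ x₀ = 0 := by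
    by_contra h
    exact hx₀ (Finsler.exists_quadraticForm_of_flagCurvature_ne_zero hF hroot hK hσ (by omega) h)
  intro x y hy
  rw [hσ x y hy, ← h0]
  exact (Finsler.isLocallyConstant_flagCurvature hF hK hσ hn).apply_eq_of_preconnectedSpace x x₀
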